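/- Let $\Gamma$ be a finite set with $N=\operatorname{card}(\Gamma)>1$. Let $\mathcal D_N$ be the Dyck inverse monoid, that is, the monoid with zero with generators $\gamma(-),\gamma(+)$ $(\gamma\in\Gamma)$ and relations $\gamma(-)\gamma(+)=\mathbf 1$ and $\gamma(-)\gamma'(+)=0$ for $\gamma\ne\gamma'$. Let $G$ be the directed labeled graph with two vertices $v_{even},v_{odd}$, with an edge labeled $0$ from $v_{even}$ to $v_{odd}$, an edge labeled $0$ from $v_{odd}$ to $v_{even}$, a loop labeled $1$ at $v_{even}$ (these three edges form the Fischer automaton of the even system), and, for every $\gamma\in\Gamma$, two loops $e(\gamma(-)),e(\gamma(+))$ at $v_{odd}$, each labeled by itself. Set $\varphi(0)=\varphi(1)=\mathbf 1$, $\varphi(e(\gamma(-)))=\gamma(-)$, $\varphi(e(\gamma(+)))=\gamma(+)$. Let $X=X(G(\lambda_{even},v_{odd},(1,1)_{\gamma\in\Gamma}))$ be the subshift with alphabet $\{0,1\}\cup\{e(\gamma(-)),e(\gamma(+)):\gamma\in\Gamma\}$ whose admissible words are the label sequences $\sigma_1\cdots\sigma_I$ of finite paths in $G$ with $\varphi(\sigma_1)\cdots\varphi(\sigma_I)\neq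 0$ in $\mathcal D_N$. Let $P_n(X)$ be the set of points of $X$ that have period $n$ (not necessarily as least period) under the shift, let $\mathcal L_n(X)$ be the set of words of length $n$ that appear in points of $X$, and let $$\zeta_X(z)=\exp\Big(\sum_{n\ge1}\tfrac1n\operatorname{card}(P_n(X))\,z^n\Big),\qquad h(X)=\lim_{n\to\infty}\tfrac1n\log\operatorname{card}(\mathcal L_n(X)).$$ Then, for every complex number $z$ with $|z|<\dfrac{N+2-\sqrt{(N+2)^2-4N}}{2N}$, the series in the definition of $\zeta_X(z)$ converges absolutely and, with the principal branch of the square root, $$\zeta_X(z)=\frac{2(1+z)\big(1-z-z^2+\sqrt{(1-z-z^2)^2-4Nz^2(1-z)^2}\big)}{\big(1-(2N+1)z+(2N-1)z^2+\sqrt{(1-z-z^2)^2-4Nz^2(1-z)^2}\big)^2}.$$ Moreover, the limit that defines the topological entropy exists, and $$h(X)=\log 2+\log N-\log\big(N+2-\sqrt{(N+2)^2-4N}\big).$$ -/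

import Mathlib

/-! Subshifts over `ℤ`: language, zeta function and topological entropy. -/

namespace SymbDyn

open SymbolicDynamics

/-- The word `x_i x_{i+1} ⋯ x_{i+n-1}` of length `n` that is read in `x` from the position `i` on. -/
def factor {A : Type*} (x : ℤ → A) (i : ℤ) (n : ℕ) : List A :=
  List.ofFn fun k : Fin n => x (i + (k : ℕ))

/-- `𝓛_n(Y)`: the words of length `n` that appear somewhere in a point of `Y`. -/
def languageOfLength {A : Type*} (Y : Set (ℤ → A)) (n : ℕ) : Set (List A) :=
  {w | ∃ x ∈ Y, ∃ i : ℤ, w = factor x i n}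

/-- `P_n(Y)`: the points of `Y` that have period `n` (not necessarily as their least period)
under the shift `(x_i) ↦ (x_{i+1})`. -/
def periodicPoints {A : Type*} (Y : Set (ℤ → A)) (n : ℕ) : Set (ℤ → A) :=
  Y ∩ Function.ptsOfPeriod (FullShift.shift (1 : ℤ)) n

/-- The `n`-th term, with `n` shifted by one, of the series `∑_{n ≥ 1} (1 / n) card (P_n(Y)) z ^ n`. -/
noncomputable def zetaTerm {A : Type*} (Y : Set (ℤ → A)) (z : ℂ) (n : ℕ) : ℂ :=
  1 / ((n + 1 : ℕ) : ℂ) * ((periodicPoints Y (n + 1)).ncard : ℂ) * z ^ (n + 1)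

/-- The zeta function `ζ_Y(z) = exp (∑_{n ≥ 1} (1 / n) card (P_n(Y)) z ^ n)`, meaningful where the
series converges. -/
noncomputable def zeta {A : Type*} (Y : Set (ℤ → A)) (z : ℂ) : ℂ :=
  Complex.exp (∑' n : ℕ, zetaTerm Y z n)

/-- `h` is the topological entropy of `Y`: the limit of `(1 / n) log (card 𝓛_n(Y))` exists and
is equal to `h`. -/
def HasEntropy {A : Type*} (Y : Set (ℤ → A)) (h : ℝ) : Prop :=
  Filter.Tendsto (fun n : ℕ => 1 / (n : ℝ) * Real.log ((languageOfLength Y n).ncard : ℝ))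
    Filter.atTop (nhds h)

/-! The Dyck inverse monoid, and admissibility in the Motzkin shift. -/

/-- The generators `γ(-)`, `γ(+)`, `γ ∈ Γ`. -/
inductive DyckGen (Γ : Type*) where
  | neg : Γ → DyckGen Γ
  | pos : Γ → DyckGen Γ

/-- The monoid with zero that is freely generated by the `γ(-)`, `γ(+)`. -/
abbrev FreeDyck (Γ : Type*) := WithZero (FreeMonoid (DyckGen Γ))

/-- A generator as an element of the free monoid with zero. -/
def FreeDyck.of {Γ : Type*} (g : DyckGen Γ) : FreeDyck Γ :=
  ((FreeMonoid.of g : FreeMonoid (DyckGen Γ)) : WithZero (FreeMonoid (DyckGen Γ)))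

/-- The defining relations: `γ(-) γ(+) = 1`, and `γ(-) γ'(+) = 0` for `γ ≠ γ'`. -/
inductive DyckRel (Γ : Type*) : FreeDyck Γ → FreeDyck Γ → Prop where
  | same (γ : Γ) : DyckRel Γ (FreeDyck.of (.neg γ) * FreeDyck.of (.pos γ)) 1
  | diff (γ γ' : Γ) (h : γ ≠ γ') :
      DyckRel Γ (FreeDyck.of (.neg γ) * FreeDyck.of (.pos γ')) 0

/-- The Dyck inverse monoid (polycyclic monoid) on `Γ`: the monoid with zero that is presented by
the generators `γ(-)`, `γ(+)` and the relations above. -/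
abbrev DyckMonoid (Γ : Type*) := (conGen (DyckRel Γ)).Quotient

namespace DyckMonoid

/-- The quotient map onto the Dyck inverse monoid. -/
def mk (Γ : Type*) : FreeDyck Γ →* DyckMonoid Γ := (conGen (DyckRel Γ)).mk'

/-- `γ(-)`. -/
def neg {Γ : Type*} (γ : Γ) : DyckMonoid Γ := mk Γ (FreeDyck.of (.neg γ))

/-- `γ(+)`. -/
def pos {Γ : Type*} (γ : Γ) : DyckMonoid Γ := mk Γ (FreeDyck.of (.pos γ))

/-- The zero element. -/
def zero (Γ : Type*) : DyckMonoid Γ := mk Γ 0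

end DyckMonoid

/-- The alphabet `{γ(-), γ(+) : γ ∈ Γ} ∪ {1}` of the Motzkin shift. -/
abbrev MotzkinSymbol (Γ : Type*) := Option (DyckGen Γ)

/-- The element of the Dyck inverse monoid that a symbol of the Motzkin shift stands for. -/
def MotzkinSymbol.value {Γ : Type*} : MotzkinSymbol Γ → DyckMonoid Γ
  | none => 1
  | some (.neg γ) => DyckMonoid.neg γ
  | some (.pos γ) => DyckMonoid.pos γ

/-- A word is admissible for the Motzkin shift if the product of its symbols in the Dyck inverse
monoid is not zero. -/
def MotzkinAdmissible {Γ : Type*} (w : List (MotzkinSymbol Γ)) : Prop :=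
  (w.map MotzkinSymbol.value).prod ≠ DyckMonoid.zero Γ

/-! Labeled directed graphs, and the attachment of loops to a vertex. -/

/-- A directed graph with vertices `V` and edges `E`, labeled by symbols in `S`. -/
structure LabeledGraph (V E S : Type*) where
  src : E → V
  tgt : E → V
  label : E → S

/-- A finite sequence of edges is a path if each edge starts where its predecessor ends. -/
def LabeledGraph.IsPath {V E S : Type*} (G : LabeledGraph V E S) (p : List E) : Prop :=
  p.IsChain fun e f => G.tgt e = G.src f

/-- The set `S` enlarged by the symbols `e(γ(-), k)`, `k` ranging over `Kneg γ` values, and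
`e(γ(+), k)`, `k` ranging over `Kpos γ` values. -/
inductive Attach (S : Type*) {Γ : Type*} (Kneg Kpos : Γ → ℕ) where
  | base : S → Attach S Kneg Kpos
  | neg (γ : Γ) (k : Fin (Kneg γ)) : Attach S Kneg Kpos
  | pos (γ : Γ) (k : Fin (Kpos γ)) : Attach S Kneg Kpos

instance {S Γ : Type*} (Kneg Kpos : Γ → ℕ) : TopologicalSpace (Attach S Kneg Kpos) := ⊥

instance {S Γ : Type*} (Kneg Kpos : Γ → ℕ) : DiscreteTopology (Attach S Kneg Kpos) := ⟨rfl⟩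

/-- `G(λ, v, (Kneg γ, Kpos γ)_γ)`: the labeled graph `G` with loops `e(γ(-), k)` and `e(γ(+), k)`
attached to the vertex `v`; these loops are labeled by themselves. -/
def LabeledGraph.attach {V E S Γ : Type*} (G : LabeledGraph V E S) (v : V) (Kneg Kpos : Γ → ℕ) :
    LabeledGraph V (Attach E Kneg Kpos) (Attach S Kneg Kpos) where
  src
    | .base e => G.src e
    | .neg _ _ => v
    | .pos _ _ => v
  tgt
    | .base e => G.tgt e
    | .neg _ _ => v
    | .pos _ _ => v
  label
    | .base e => .base (G.label e)
    | .neg γ k => .neg γ k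
    | .pos γ k => .pos γ k

/-- The map `φ` that sends the original labels to `1`, and `e(γ(-), k)` to `γ(-)` and `e(γ(+), k)`
to `γ(+)`. -/
def Attach.φ {S Γ : Type*} {Kneg Kpos : Γ → ℕ} : Attach S Kneg Kpos → MotzkinSymbol Γ
  | .base _ => none
  | .neg γ _ => some (.neg γ)
  | .pos γ _ => some (.pos γ)

/-- The words that are declared admissible: the label sequences of those paths in
`G(λ, v, (Kneg γ, Kpos γ)_γ)` whose label sequence is mapped by `φ` to an admissible word of the
Motzkin shift. -/
def admissibleWords {V E S Γ : Type*} (G : LabeledGraph V E S) (v : V) (Kneg Kpos : Γ → ℕ) :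
    Set (List (Attach S Kneg Kpos)) :=
  {w | ∃ p : List (Attach E Kneg Kpos), (G.attach v Kneg Kpos).IsPath p ∧
    MotzkinAdmissible ((p.map (G.attach v Kneg Kpos).label).map Attach.φ) ∧
    w = p.map (G.attach v Kneg Kpos).label}

/-- The subshift `X(G(λ, v, (Kneg γ, Kpos γ)_γ))`: the bi-infinite sequences all of whose finite
words are admissible. -/
def attachShift {V E S Γ : Type*} (G : LabeledGraph V E S) (v : V) (Kneg Kpos : Γ → ℕ) :
    FullShift.Subshift (Attach S Kneg Kpos) ℤ where
  carrier := {x | ∀ (i : ℤ) (n : ℕ), factor x i n ∈ admissibleWords G v Kneg Kpos}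
  isClosed := by
    have h : {x : ℤ → Attach S Kneg Kpos |
          ∀ (i : ℤ) (n : ℕ), factor x i n ∈ admissibleWords G v Kneg Kpos}
        = ⋂ (i : ℤ) (n : ℕ), (fun (x : ℤ → Attach S Kneg Kpos) (k : Fin n) => x (i + (k : ℕ))) ⁻¹'
          {y | List.ofFn y ∈ admissibleWords G v Kneg Kpos} := by
      ext x
      simp [factor]
    rw [h]
    refine isClosed_iInter fun i => isClosed_iInter fun n => ?_
    exact (isClosed_discrete _).preimage (by fun_prop)
  mapsTo := by
    intro g x hx i n
    have := hx (g + i) n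
    simpa [factor, FullShift.shift_apply, add_assoc] using this

/-! The Fischer automaton of the even system. -/

inductive EvenVertex where
  | even
  | odd

inductive EvenEdge where
  | evenToOdd
  | oddToEven
  | loop

/-- The Fischer automaton of the even system: edges with the label `0` from `v_even` to `v_odd` and
from `v_odd` to `v_even`, and a loop with the label `1` at `v_even`. -/
def evenAutomaton : LabeledGraph EvenVertex EvenEdge (Fin 2) where
  src
    | .evenToOdd => .even
    | .oddToEven => .odd
    | .loop => .even
  tgt
    | .evenToOdd => .odd
    | .oddToEven => .even
    | .loop => .even
  label
    | .evenToOdd => 0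
    | .oddToEven => 0
    | .loop => 1

/-- The subshift `X(G(λ_even, v_odd, (1, 1)_{γ ∈ Γ}))`. -/
def evenOddShift (Γ : Type*) :
    FullShift.Subshift (Attach (Fin 2) (fun _ : Γ => 1) (fun _ : Γ => 1)) ℤ :=
  attachShift evenAutomaton .odd (fun _ : Γ => 1) (fun _ : Γ => 1)

end SymbDyn

/-! A point of period n is determined by the word w on one period. It lies in the shift exactly when
w = 0^n, or w labels a closed path at one of the two vertices and every power of its Dyck part is
nonzero. Only 0^n can be read from both vertices; it is closed at both for even n and at neither for
odd n. So card P_n is the number of closed words at the two vertices plus (-1)^(n+1)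
(`ncard_periodicPoints`).

Fix a path and the kinds of its brackets and let only the indices vary: with o opening and c closing
brackets, N^max(o,c) indexings are cyclically admissible (`labelSum_cyclicallyAdmissible`). With σ
f(j,k) = f(j+1,k) + f(j,k+1) recording one bracket, the closed words are counted by the trace of
M^n, M = [[1,1],[1,σ]], applied to N^max(j,k) at (0,0). Since det(1 - zM) = (1-z-z²)(1-vσ) with v =
z(1-z)/(1-z-z²), the zeta function is (1+z)/(1-z-z²) times the zeta function of the Dyck shift at v,
the factor 1+z coming from the signs. This is proved by logarithmic derivatives: Cayley-Hamilton
gives `tsum_traceCoeff_recursion`, the resolvent of σ is found explicitly in `hasSum_diagCoeff`,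
`hasDerivAt_dyckZeta` recognises the result, and `zeta_eq_closedForm` integrates. Finally
`sqrt_eq_evenDen_mul` checks the branch of the square root.

Growth is governed by l, the larger root of l² - (N+2)l + N. The weight N^max(j,k) lies between N^j
and N^j + N^k, both eigenvectors of σ for N+1, and l is the larger eigenvalue of [[1,1],[1,N+1]];
the stated radius is 1/l. The entropy is log l: periodic points supply at least l^n/2 words, and
`pathSum_labelCount_le` bounds the words above by l^n times a linear factor. -/

namespace SymbDyn

/-! ### Normal forms in the Dyck inverse monoid -/

namespace DyckMonoid

variable {Γ : Type*}

theorem zero_mul' (x : DyckMonoid Γ) : zero Γ * x = zero Γ := by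
  induction x using Con.induction_on with
  | H y =>
    change mk Γ 0 * mk Γ y = mk Γ 0
    rw [← map_mul, zero_mul]

theorem mul_zero' (x : DyckMonoid Γ) : x * zero Γ = zero Γ := by
  induction x using Con.induction_on with
  | H y =>
    change mk Γ y * mk Γ 0 = mk Γ 0
    rw [← map_mul, mul_zero]

theorem neg_mul_pos_self (γ : Γ) : neg γ * pos γ = 1 := by
  rw [neg, pos, ← map_mul, ← map_one (mk Γ)]
  exact (Con.eq _).2 (ConGen.Rel.of _ _ (.same γ))

theorem neg_mul_pos_of_ne {γ γ' : Γ} (h : γ ≠ γ') : neg γ * pos γ' = zero Γ := by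
  rw [neg, pos, ← map_mul, zero]
  exact (Con.eq _).2 (ConGen.Rel.of _ _ (.diff γ γ' h))

/-- The element `P₁(+) ⋯ P_p(+) Q_q(-) ⋯ Q₁(-)`. -/
def normal (x : List Γ × List Γ) : DyckMonoid Γ :=
  (x.1.map pos).prod * (x.2.reverse.map neg).prod

/-- Push a letter on a stack, extended linearly. -/
noncomputable def push (γ : Γ) : Module.End ℤ (List Γ →₀ ℤ) :=
  Finsupp.lmapDomain ℤ ℤ (List.cons γ)

open Classical in
/-- Remove the letter `γ` from the top of a stack, extended linearly; the result is `0` if `γ` is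
not on top. -/
noncomputable def pop (γ : Γ) : Module.End ℤ (List Γ →₀ ℤ) :=
  Finsupp.lift (List Γ →₀ ℤ) ℤ (List Γ) fun l =>
    if l.head? = some γ then Finsupp.single l.tail 1 else 0

theorem push_single (γ : Γ) (l : List Γ) :
    push γ (Finsupp.single l 1) = Finsupp.single (γ :: l) 1 := by
  simp [push]

theorem pop_single_cons (γ : Γ) (l : List Γ) :
    pop γ (Finsupp.single (γ :: l) 1) = Finsupp.single l 1 := by
  simp [pop]

theorem pop_single_cons_of_ne {γ γ' : Γ} (h : γ' ≠ γ) (l : List Γ) :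
    pop γ (Finsupp.single (γ' :: l) 1) = 0 := by
  simp [pop, h]

/-- The action of the generators on stacks. -/
noncomputable def genAction : DyckGen Γ → Module.End ℤ (List Γ →₀ ℤ)
  | .neg γ => pop γ
  | .pos γ => push γ

/-- The action of the free monoid with zero on stacks. -/
noncomputable def freeAction : FreeDyck Γ →* Module.End ℤ (List Γ →₀ ℤ) :=
  (WithZero.lift' (FreeMonoid.lift genAction)).toMonoidHom

theorem freeAction_of (g : DyckGen Γ) : freeAction (FreeDyck.of g) = genAction g := by
  simp [freeAction, FreeDyck.of]

theorem freeAction_zero : freeAction (0 : FreeDyck Γ) = 0 := by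
  simp [freeAction]

/-- The action of the Dyck inverse monoid on stacks: `γ(+)` pushes and `γ(-)` pops. -/
noncomputable def action : DyckMonoid Γ →* Module.End ℤ (List Γ →₀ ℤ) :=
  Con.lift _ freeAction (by
    refine Con.conGen_le.2 fun a b h => ?_
    change freeAction a = freeAction b
    cases h with
    | same γ =>
      rw [map_mul, map_one, freeAction_of, freeAction_of]
      refine Finsupp.lhom_ext' fun l => LinearMap.ext_ring ?_
      simp [genAction, push_single, pop_single_cons]
    | diff γ γ' h =>
      rw [map_mul, freeAction_zero, freeAction_of, freeAction_of]
      refine Finsupp.lhom_ext' fun l => LinearMap.ext_ring ?_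
      simp [genAction, push_single, pop_single_cons_of_ne h.symm])

theorem action_mk (y : FreeDyck Γ) : action (mk Γ y) = freeAction y :=
  Con.lift_mk' _ _

theorem action_neg (γ : Γ) : action (neg γ) = pop γ := by
  rw [neg, action_mk, freeAction_of]; rfl

theorem action_pos (γ : Γ) : action (pos γ) = push γ := by
  rw [pos, action_mk, freeAction_of]; rfl

theorem action_zero : action (zero Γ) = 0 := by
  rw [zero, action_mk, freeAction_zero]

/-- A presentation does not show which products survive; the action on stacks does, because zero
acts as the zero map and basis vectors are nonzero. -/
theorem ne_zero_of_action {x : DyckMonoid Γ} {l l' : List Γ}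
    (h : action x (Finsupp.single l 1) = Finsupp.single l' 1) : x ≠ zero Γ := by
  rintro rfl
  rw [action_zero] at h
  have := congrArg (fun f => f l') h
  simp at this

theorem action_map_pos (P S : List Γ) :
    action (P.map pos).prod (Finsupp.single S 1) = Finsupp.single (P ++ S) 1 := by
  induction P with
  | nil => simp
  | cons γ P ih => simp [ih, action_pos, push_single]

theorem action_map_neg (Q S : List Γ) :
    action (Q.reverse.map neg).prod (Finsupp.single (Q ++ S) 1) = Finsupp.single S 1 := by
  induction Q with
  | nil => simp
  | cons γ Q ih => simpa [action_neg, pop_single_cons] using ih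

theorem action_normal (P Q S : List Γ) :
    action (normal (P, Q)) (Finsupp.single (Q ++ S) 1) = Finsupp.single (P ++ S) 1 := by
  rw [normal, map_mul, Module.End.mul_apply, action_map_neg, action_map_pos]

theorem normal_ne_zero (x : List Γ × List Γ) : normal x ≠ zero Γ := by
  have := action_normal x.1 x.2 []
  exact ne_zero_of_action this

/-- Each application inserts one copy of R directly below Q and leaves Q on top, ready for the next
application. -/
theorem action_normal_pow_of_append_left (Q R S : List Γ) (k : ℕ) :
    action (normal (Q ++ R, Q) ^ k) (Finsupp.single (Q ++ S) 1) =
      Finsupp.single (Q ++ ((List.replicate k R).flatten ++ S)) 1 := by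
  induction k generalizing S with
  | zero => simp
  | succ k ih =>
    rw [pow_succ, map_mul, Module.End.mul_apply, action_normal, List.append_assoc, ih,
      List.replicate_succ']
    simp

/-- Each application consumes one copy of R below P, so a stack prepared with k copies survives k
applications. -/
theorem action_normal_pow_of_append_right (P R S : List Γ) (k : ℕ) :
    action (normal (P, P ++ R) ^ k)
      (Finsupp.single (P ++ ((List.replicate k R).flatten ++ S)) 1) =
      Finsupp.single (P ++ S) 1 := by
  induction k generalizing S with
  | zero => simp
  | succ k ih =>
    rw [pow_succ, map_mul, Module.End.mul_apply, List.replicate_succ, List.flatten_cons,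
      List.append_assoc R, ← List.append_assoc P R, action_normal, ih]

end DyckMonoid

/-- One of two lists is a prefix of the other. -/
def Compatible {Γ : Type*} : List Γ → List Γ → Prop
  | [], _ => True
  | _ :: _, [] => True
  | a :: P, b :: Q => a = b ∧ Compatible P Q

theorem Compatible.exists_append {Γ : Type*} : ∀ {P Q : List Γ}, Compatible P Q →
    (∃ R, P = Q ++ R) ∨ ∃ R, Q = P ++ R
  | [], Q, _ => .inr ⟨Q, rfl⟩
  | a :: P, [], _ => .inl ⟨a :: P, rfl⟩
  | a :: P, b :: Q, h' => by
    obtain ⟨rfl, h⟩ := h'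
    rcases h.exists_append with ⟨R, rfl⟩ | ⟨R, rfl⟩
    · exact .inl ⟨R, rfl⟩
    · exact .inr ⟨R, rfl⟩

namespace DyckMonoid

variable {Γ : Type*}

theorem normal_pow_ne_zero {P Q : List Γ} (h : Compatible P Q) (k : ℕ) :
    normal (P, Q) ^ k ≠ zero Γ := by
  rcases h.exists_append with ⟨R, rfl⟩ | ⟨R, rfl⟩
  · exact ne_zero_of_action (action_normal_pow_of_append_left Q R [] k)
  · exact ne_zero_of_action (action_normal_pow_of_append_right P R [] k)

/-- Equal letters cancel from the middle outwards until the first mismatch, which makes the product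
zero. -/
theorem neg_mul_pos_eq_zero : ∀ {P Q : List Γ}, ¬ Compatible P Q →
    (Q.reverse.map neg).prod * (P.map pos).prod = zero Γ
  | [], _, h => (h trivial).elim
  | _ :: _, [], h => (h trivial).elim
  | a :: P, b :: Q, h => by
    have key : ((b :: Q).reverse.map neg).prod * ((a :: P).map pos).prod =
        (Q.reverse.map neg).prod * (neg b * pos a) * (P.map pos).prod := by
      simp [mul_assoc]
    rw [key]
    by_cases hab : a = b
    · subst hab
      rw [neg_mul_pos_self, mul_one]
      exact neg_mul_pos_eq_zero fun hc => h ⟨rfl, hc⟩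
    · rw [neg_mul_pos_of_ne (Ne.symm hab), mul_zero', zero_mul']

theorem normal_mul_self_eq_zero {P Q : List Γ} (h : ¬ Compatible P Q) :
    normal (P, Q) * normal (P, Q) = zero Γ := by
  have := neg_mul_pos_eq_zero h
  calc normal (P, Q) * normal (P, Q) = (P.map pos).prod *
        ((Q.reverse.map neg).prod * (P.map pos).prod) * (Q.reverse.map neg).prod := by
        simp only [normal, mul_assoc]
    _ = zero Γ := by rw [this, mul_zero', zero_mul']

end DyckMonoid

/-! ### Reduction of words to normal form and cyclic admissibility -/

section reduce

variable {Γ : Type*}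

open Classical in
/-- Multiplication of a normal form by a symbol from the left; `none` stands for zero. -/
noncomputable def reduceStep : MotzkinSymbol Γ → List Γ × List Γ → Option (List Γ × List Γ)
  | none, x => some x
  | some (.pos γ), (P, Q) => some (γ :: P, Q)
  | some (.neg γ), ([], Q) => some ([], Q ++ [γ])
  | some (.neg γ), (δ :: P, Q) => if δ = γ then some (P, Q) else none

/-- The normal form of a word; `none` stands for zero. -/
noncomputable def reduce : List (MotzkinSymbol Γ) → Option (List Γ × List Γ)
  | [] => some ([], [])
  | a :: w => (reduce w).bind (reduceStep a)

/-- The element of the Dyck inverse monoid with a given normal form. -/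
def optNormal : Option (List Γ × List Γ) → DyckMonoid Γ
  | none => DyckMonoid.zero Γ
  | some x => DyckMonoid.normal x

theorem value_mul_normal (a : MotzkinSymbol Γ) (x : List Γ × List Γ) :
    a.value * DyckMonoid.normal x = optNormal (reduceStep a x) := by
  rcases a with _ | (γ | γ) <;> rcases x with ⟨_ | ⟨δ, P⟩, Q⟩
  · simp [reduceStep, optNormal, MotzkinSymbol.value]
  · simp [reduceStep, optNormal, MotzkinSymbol.value]
  · simp [reduceStep, optNormal, MotzkinSymbol.value, DyckMonoid.normal]
  · by_cases h : δ = γ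
    · subst h
      simp [reduceStep, optNormal, MotzkinSymbol.value, DyckMonoid.normal, ← mul_assoc,
        DyckMonoid.neg_mul_pos_self]
    · simp [reduceStep, optNormal, MotzkinSymbol.value, DyckMonoid.normal, ← mul_assoc, h,
        DyckMonoid.neg_mul_pos_of_ne (Ne.symm h), DyckMonoid.zero_mul']
  · simp [reduceStep, optNormal, MotzkinSymbol.value, DyckMonoid.normal]
  · simp [reduceStep, optNormal, MotzkinSymbol.value, DyckMonoid.normal, mul_assoc]

theorem prod_value (w : List (MotzkinSymbol Γ)) :
    (w.map MotzkinSymbol.value).prod = optNormal (reduce w) := by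
  induction w with
  | nil => simp [reduce, optNormal, DyckMonoid.normal]
  | cons a w ih =>
    rw [List.map_cons, List.prod_cons, ih, reduce]
    cases reduce w with
    | none => simp [optNormal, DyckMonoid.mul_zero']
    | some x => exact value_mul_normal a x

theorem motzkinAdmissible_iff (w : List (MotzkinSymbol Γ)) :
    MotzkinAdmissible w ↔ ∃ x, reduce w = some x := by
  rw [MotzkinAdmissible, prod_value]
  cases reduce w with
  | none => simp [optNormal]
  | some x => simp [optNormal, DyckMonoid.normal_ne_zero]

theorem MotzkinAdmissible.of_infix {u w : List (MotzkinSymbol Γ)} (h : u <:+: w)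
    (hw : MotzkinAdmissible w) : MotzkinAdmissible u := by
  obtain ⟨s, t, rfl⟩ := h
  intro hu
  apply hw
  simp [hu, DyckMonoid.mul_zero', DyckMonoid.zero_mul']

/-- A word is cyclically reducible to a nonzero element. -/
def CyclicallyAdmissible (w : List (MotzkinSymbol Γ)) : Prop :=
  ∃ P Q, reduce w = some (P, Q) ∧ Compatible P Q

theorem CyclicallyAdmissible.flatten_replicate {w : List (MotzkinSymbol Γ)}
    (h : CyclicallyAdmissible w) (k : ℕ) : MotzkinAdmissible (List.replicate k w).flatten := by
  obtain ⟨P, Q, h1, h2⟩ := h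
  have : ((List.replicate k w).flatten.map MotzkinSymbol.value).prod =
      DyckMonoid.normal (P, Q) ^ k := by
    rw [List.map_flatten, List.prod_flatten]
    simp [prod_value, h1, optNormal]
  rw [MotzkinAdmissible, this]
  exact DyckMonoid.normal_pow_ne_zero h2 k

/-- The square alone decides whether all powers are nonzero: with incompatible P and Q it already
vanishes. -/
theorem MotzkinAdmissible.cyclicallyAdmissible {w : List (MotzkinSymbol Γ)}
    (h : MotzkinAdmissible (w ++ w)) : CyclicallyAdmissible w := by
  obtain ⟨⟨P, Q⟩, hx⟩ := (motzkinAdmissible_iff w).1 (h.of_infix (List.prefix_append w w).isInfix)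
  refine ⟨P, Q, hx, ?_⟩
  by_contra hc
  apply h
  rw [List.map_append, List.prod_append, prod_value, hx]
  exact DyckMonoid.normal_mul_self_eq_zero hc

end reduce


/-! ### Factors and periodic sequences -/

section factor

variable {A : Type*}

@[simp] theorem length_factor (x : ℤ → A) (i : ℤ) (n : ℕ) : (factor x i n).length = n := by
  simp [factor]

theorem getElem_factor (x : ℤ → A) (i : ℤ) (n k : ℕ) (h : k < (factor x i n).length) :
    (factor x i n)[k] = x (i + k) := by
  simp [factor]

theorem factor_add (x : ℤ → A) (i : ℤ) (a b : ℕ) :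
    factor x i (a + b) = factor x i a ++ factor x (i + a) b := by
  refine List.ext_getElem (by simp) fun k h1 h2 => ?_
  rw [List.getElem_append]
  split_ifs with h
  · simp [getElem_factor]
  · rw [getElem_factor, getElem_factor]
    rw [length_factor] at h ⊢
    congr 1
    omega

theorem factor_const (a : A) (i : ℤ) (n : ℕ) :
    factor (fun _ => a) i n = List.replicate n a := by
  simp [factor]

theorem mem_periodicPoints {Y : Set (ℤ → A)} {n : ℕ} {x : ℤ → A} :
    x ∈ periodicPoints Y n ↔ x ∈ Y ∧ ∀ i : ℤ, x (i + n) = x i := by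
  have key : ∀ (n : ℕ) (i : ℤ), (SymbolicDynamics.FullShift.shift (1 : ℤ))^[n] x i = x (i + n) := by
    intro n
    induction n with
    | zero => simp
    | succ n ih =>
      intro i
      rw [Function.iterate_succ_apply', SymbolicDynamics.FullShift.shift_apply, ih]
      congr 1
      push_cast
      ring
  rw [periodicPoints, Set.mem_inter_iff, Function.mem_ptsOfPeriod, Function.IsPeriodicPt,
    Function.IsFixedPt, funext_iff]
  simp only [key]

variable {x : ℤ → A} {n : ℕ}

theorem apply_add_mul_of_period (h : ∀ i : ℤ, x (i + n) = x i) (i q : ℤ) :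
    x (i + q * n) = x i := by
  have hp : Function.Periodic x (n : ℤ) := h
  simpa using hp.int_mul q i

theorem factor_add_mul_of_period (h : ∀ i : ℤ, x (i + n) = x i) (i q : ℤ) (k : ℕ) :
    factor x (i + q * n) k = factor x i k := by
  refine List.ext_getElem (by simp) fun j h1 h2 => ?_
  rw [getElem_factor, getElem_factor, add_right_comm, apply_add_mul_of_period h]

theorem factor_mul_of_period (h : ∀ i : ℤ, x (i + n) = x i) (m : ℕ) :
    factor x 0 (m * n) = (List.replicate m (factor x 0 n)).flatten := by
  induction m with
  | zero => simp [factor]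
  | succ m ih =>
    rw [Nat.succ_mul, factor_add, ih, List.replicate_succ', List.flatten_append]
    have := factor_add_mul_of_period h 0 m n
    push_cast at this ⊢
    rw [this]
    simp

theorem factor_infix_of_period (hn : 0 < n) (h : ∀ i : ℤ, x (i + n) = x i) (i : ℤ) (k : ℕ) :
    ∃ m, factor x i k <:+: (List.replicate m (factor x 0 n)).flatten := by
  have hi : i = ((i % n).toNat : ℕ) + (i / n) * n := by
    rw [Int.toNat_of_nonneg (Int.emod_nonneg _ (by omega))]
    exact (Int.emod_add_ediv_mul i n).symm
  set r := (i % n).toNat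
  rw [hi, factor_add_mul_of_period h]
  -- As n ≥ 1, these many periods have length at least r + k and so cover the positions from 0 to r
  -- + k - 1.
  refine ⟨r + k, ?_⟩
  rw [← factor_mul_of_period h]
  obtain ⟨t, ht⟩ := Nat.exists_eq_add_of_le (Nat.le_mul_of_pos_right (r + k) hn)
  rw [ht, factor_add, factor_add]
  exact ⟨factor x 0 r, _, by rw [zero_add]⟩

theorem eq_of_factor_eq_of_period {y : ℤ → A} (hn : 0 < n) (hx : ∀ i : ℤ, x (i + n) = x i)
    (hy : ∀ i : ℤ, y (i + n) = y i) (h : factor x 0 n = factor y 0 n) : x = y := by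
  funext i
  have hi : i = ((i % n).toNat : ℕ) + (i / n) * n := by
    rw [Int.toNat_of_nonneg (Int.emod_nonneg _ (by omega))]
    exact (Int.emod_add_ediv_mul i n).symm
  have hr : (i % n).toNat < n := by
    have := Int.emod_lt_of_pos i (by omega : (0 : ℤ) < n)
    omega
  rw [hi, apply_add_mul_of_period hx, apply_add_mul_of_period hy]
  have h1 := getElem_factor x 0 n (i % n).toNat (by simpa using hr)
  have h2 := getElem_factor y 0 n (i % n).toNat (by simpa using hr)
  rw [zero_add] at h1 h2
  rw [← h1, ← h2]
  congr 1

theorem exists_period_factor_eq (hn : 0 < n) (w : List A) (hw : w.length = n) :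
    ∃ x : ℤ → A, (∀ i : ℤ, x (i + n) = x i) ∧ factor x 0 n = w := by
  have hlt : ∀ i : ℤ, (i % n).toNat < w.length := fun i => by
    have := Int.emod_lt_of_pos i (by omega : (0 : ℤ) < n)
    omega
  refine ⟨fun i => w[(i % n).toNat]'(hlt i), fun i => by simp, ?_⟩
  refine List.ext_getElem (by simp [hw]) fun k h1 h2 => ?_
  rw [getElem_factor]
  have : ((0 + (k : ℤ)) % n).toNat = k := by
    rw [zero_add, ← Int.natCast_mod, Int.toNat_natCast, Nat.mod_eq_of_lt (hw ▸ h2)]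
  simp only [this]

end factor

/-! ### The label automaton -/

/-- The alphabet `{0, 1} ∪ {e(γ(-)), e(γ(+)) : γ ∈ Γ}`. -/
abbrev EvenOddSymbol (Γ : Type*) := Attach (Fin 2) (fun _ : Γ => 1) (fun _ : Γ => 1)

variable {Γ : Type*}

/-- The symbol `0`. -/
abbrev sZero : EvenOddSymbol Γ := .base 0
/-- The symbol `1`. -/
abbrev sOne : EvenOddSymbol Γ := .base 1
/-- The symbol `e(γ(-))`. -/
abbrev sNeg (γ : Γ) : EvenOddSymbol Γ := .neg γ 0
/-- The symbol `e(γ(+))`. -/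
abbrev sPos (γ : Γ) : EvenOddSymbol Γ := .pos γ 0

theorem EvenOddSymbol.cases' (a : EvenOddSymbol Γ) :
    a = sZero ∨ a = sOne ∨ (∃ γ, a = sNeg γ) ∨ ∃ γ, a = sPos γ := by
  rcases a with i | ⟨γ, k⟩ | ⟨γ, k⟩
  · fin_cases i <;> simp
  · have : k = 0 := Subsingleton.elim _ _
    simp [this]
  · have : k = 0 := Subsingleton.elim _ _
    simp [this]

/-- The terminal vertex of the edge with a given label that leaves a given vertex. -/
def step : EvenVertex → EvenOddSymbol Γ → Option EvenVertex
  | .even, .base i => some (if i = 0 then .odd else .even)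
  | .odd, .base i => if i = 0 then some .even else none
  | .even, .neg _ _ => none
  | .even, .pos _ _ => none
  | .odd, .neg _ _ => some .odd
  | .odd, .pos _ _ => some .odd

/-- The terminal vertex of the path with a given label that leaves a given vertex. -/
def run : EvenVertex → List (EvenOddSymbol Γ) → Option EvenVertex
  | v, [] => some v
  | v, a :: w => (step v a).bind fun v' => run v' w

theorem run_append (v : EvenVertex) (u w : List (EvenOddSymbol Γ)) :
    run v (u ++ w) = (run v u).bind fun v' => run v' w := by
  induction u generalizing v with
  | nil => simp [run]
  | cons a u ih =>
    simp only [List.cons_append, run, Option.bind_assoc]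
    congr 1
    funext v'
    exact ih v'

/-- The graph that presents the shift. -/
abbrev evenOddGraph (Γ : Type*) := evenAutomaton.attach .odd (fun _ : Γ => 1) (fun _ : Γ => 1)

theorem step_src_label (e : Attach EvenEdge (fun _ : Γ => 1) (fun _ : Γ => 1)) :
    step ((evenOddGraph Γ).src e) ((evenOddGraph Γ).label e) = some ((evenOddGraph Γ).tgt e) := by
  rcases e with (_ | _ | _) | _ | _ <;> rfl

theorem exists_edge_of_step {v v' : EvenVertex} {a : EvenOddSymbol Γ} (h : step v a = some v') :
    ∃ e, (evenOddGraph Γ).src e = v ∧ (evenOddGraph Γ).tgt e = v' ∧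
      (evenOddGraph Γ).label e = a := by
  rcases a with i | ⟨γ, k⟩ | ⟨γ, k⟩ <;> cases v
  · fin_cases i
    · exact ⟨.base .evenToOdd, rfl, Option.some.inj h, rfl⟩
    · exact ⟨.base .loop, rfl, Option.some.inj h, rfl⟩
  · fin_cases i
    · exact ⟨.base .oddToEven, rfl, Option.some.inj h, rfl⟩
    · simp [step] at h
  · simp [step] at h
  · exact ⟨.neg γ k, rfl, Option.some.inj h, rfl⟩
  · simp [step] at h
  · exact ⟨.pos γ k, rfl, Option.some.inj h, rfl⟩

theorem run_of_isPath (e : Attach EvenEdge (fun _ : Γ => 1) (fun _ : Γ => 1))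
    (p : List (Attach EvenEdge (fun _ : Γ => 1) (fun _ : Γ => 1)))
    (h : (evenOddGraph Γ).IsPath (e :: p)) :
    ∃ v, run ((evenOddGraph Γ).src e) ((e :: p).map (evenOddGraph Γ).label) = some v := by
  induction p generalizing e with
  | nil => exact ⟨(evenOddGraph Γ).tgt e, by simp [run, step_src_label]⟩
  | cons f p ih =>
    rw [LabeledGraph.IsPath, List.isChain_cons_cons] at h
    obtain ⟨v, hv⟩ := ih f h.2
    refine ⟨v, ?_⟩
    rw [List.map_cons, run, step_src_label, Option.bind_some, h.1, hv]

theorem exists_isPath_of_run {v v' : EvenVertex} {w : List (EvenOddSymbol Γ)}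
    (h : run v w = some v') : ∃ p, (evenOddGraph Γ).IsPath p ∧
      p.map (evenOddGraph Γ).label = w ∧ ∀ e ∈ p.head?, (evenOddGraph Γ).src e = v := by
  induction w generalizing v with
  | nil => exact ⟨[], List.isChain_nil, rfl, by simp⟩
  | cons a w ih =>
    rw [run, Option.bind_eq_some_iff] at h
    obtain ⟨u, hu, h⟩ := h
    obtain ⟨p, hp, rfl, hs⟩ := ih h
    obtain ⟨e, he1, he2, rfl⟩ := exists_edge_of_step hu
    refine ⟨e :: p, ?_, rfl, by simpa using he1⟩
    rw [LabeledGraph.IsPath, List.isChain_cons]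
    exact ⟨fun f hf => by rw [he2, hs f hf], hp⟩

/-- The Dyck part of a word. -/
abbrev dyck (w : List (EvenOddSymbol Γ)) : List (MotzkinSymbol Γ) := w.map Attach.φ

theorem mem_admissibleWords_iff (w : List (EvenOddSymbol Γ)) :
    w ∈ admissibleWords evenAutomaton .odd (fun _ : Γ => 1) (fun _ : Γ => 1) ↔
      (∃ v v', run v w = some v') ∧ MotzkinAdmissible (dyck w) := by
  constructor
  · rintro ⟨p, hp, ha, rfl⟩
    refine ⟨?_, ha⟩
    cases p with
    | nil => exact ⟨.even, .even, rfl⟩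
    | cons e p => exact ⟨_, run_of_isPath e p hp⟩
  · rintro ⟨⟨v, v', h⟩, ha⟩
    obtain ⟨p, hp, rfl, -⟩ := exists_isPath_of_run h
    exact ⟨p, hp, ha, rfl⟩

theorem mem_evenOddShift_iff (x : ℤ → EvenOddSymbol Γ) : x ∈ (evenOddShift Γ).carrier ↔
    ∀ (i : ℤ) (n : ℕ), (∃ v v', run v (factor x i n) = some v') ∧
      MotzkinAdmissible (dyck (factor x i n)) := by
  simp only [← mem_admissibleWords_iff]
  rfl

theorem run_of_infix {u w : List (EvenOddSymbol Γ)} (h : u <:+: w)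
    (hw : ∃ v v', run v w = some v') : ∃ v v', run v u = some v' := by
  obtain ⟨s, t, rfl⟩ := h
  obtain ⟨v, v', h⟩ := hw
  rw [run_append, run_append, Option.bind_eq_some_iff] at h
  obtain ⟨v2, h, -⟩ := h
  rw [Option.bind_eq_some_iff] at h
  obtain ⟨v1, -, h⟩ := h
  exact ⟨v1, v2, h⟩

/-- Only the symbol 0 can be read at both vertices, and reading it interchanges them, so the two
runs never meet. -/
theorem eq_replicate_of_run {w : List (EvenOddSymbol Γ)} {v v' : EvenVertex}
    (h1 : run .even w = some v) (h2 : run .odd w = some v') :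
    w = List.replicate w.length sZero := by
  suffices h : ∀ (w : List (EvenOddSymbol Γ)) (u u' v v' : EvenVertex), u ≠ u' →
      run u w = some v → run u' w = some v' → w = List.replicate w.length sZero from
    h w _ _ _ _ (by simp) h1 h2
  clear h1 h2
  intro w
  induction w with
  | nil => intros; rfl
  | cons a w ih =>
    intro u u' v v' hne h1 h2
    rw [run, Option.bind_eq_some_iff] at h1 h2
    obtain ⟨t, ht, h1⟩ := h1
    obtain ⟨t', ht', h2⟩ := h2
    rw [List.length_cons, List.replicate_succ]
    rcases a.cases' with rfl | rfl | ⟨γ, rfl⟩ | ⟨γ, rfl⟩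
    · rw [← ih t t' v v' ?_ h1 h2]
      cases u <;> cases u' <;> simp_all [step] <;> simp [← ht, ← ht']
    all_goals cases u <;> cases u' <;> simp_all [step]

/-- The other vertex. -/
def EvenVertex.swap : EvenVertex → EvenVertex
  | .even => .odd
  | .odd => .even

theorem run_replicate_zero (v : EvenVertex) (n : ℕ) :
    run v (List.replicate n (sZero : EvenOddSymbol Γ)) =
      some (if Even n then v else v.swap) := by
  induction n generalizing v with
  | zero => simp [run]
  | succ n ih =>
    rw [List.replicate_succ, run]
    cases v <;> by_cases hn : Even n <;> simp [step, ih, hn, Nat.even_add_one, EvenVertex.swap]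

theorem run_flatten_replicate {w : List (EvenOddSymbol Γ)} {v : EvenVertex}
    (h : run v w = some v) (k : ℕ) : run v (List.replicate k w).flatten = some v := by
  induction k with
  | zero => rfl
  | succ k ih => rw [List.replicate_succ, List.flatten_cons, run_append, h, Option.bind_some, ih]

theorem reduce_replicate_zero (n : ℕ) :
    reduce (dyck (List.replicate n (sZero : EvenOddSymbol Γ))) = some ([], []) := by
  induction n with
  | zero => rfl
  | succ n ih =>
    rw [dyck, List.replicate_succ, List.map_cons, reduce]
    erw [ih]
    rfl

/-- The words that label closed paths at `v` and are cyclically admissible. -/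
def closedWords (Γ : Type*) (v : EvenVertex) (n : ℕ) : Set (List (EvenOddSymbol Γ)) :=
  {w | w.length = n ∧ run v w = some v ∧ CyclicallyAdmissible (dyck w)}

theorem mem_evenOddShift_iff_of_period {n : ℕ} (hn : 0 < n) {x : ℤ → EvenOddSymbol Γ}
    (hx : ∀ i : ℤ, x (i + n) = x i) : x ∈ (evenOddShift Γ).carrier ↔
      factor x 0 n ∈ closedWords Γ .even n ∪ closedWords Γ .odd n ∪
        {List.replicate n sZero} := by
  rw [mem_evenOddShift_iff]
  constructor
  · intro h
    -- Two periods carry all the information: the square tests cyclic admissibility, and the vertex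
    -- between the two copies shows whether the path closes up. If it does not, w can be read from
    -- both vertices.
    have h2 := h 0 (n + n)
    have hf : factor x 0 (n + n) = factor x 0 n ++ factor x 0 n := by
      rw [factor_add]
      have := factor_add_mul_of_period hx 0 1 n
      rw [one_mul] at this
      rw [this]
    rw [hf] at h2
    obtain ⟨⟨v, v'', hv⟩, ha⟩ := h2
    rw [dyck, List.map_append] at ha
    have hc := ha.cyclicallyAdmissible
    rw [run_append, Option.bind_eq_some_iff] at hv
    obtain ⟨v', hv', hv⟩ := hv
    have hl := length_factor x 0 n
    set w := factor x 0 n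
    by_cases hvv : v' = v
    · subst hvv
      cases v'
      · exact .inl (.inl ⟨hl, hv', hc⟩)
      · exact .inl (.inr ⟨hl, hv', hc⟩)
    · refine .inr ?_
      rw [Set.mem_singleton_iff]
      cases v <;> cases v'
      · exact (hvv rfl).elim
      · exact hl ▸ eq_replicate_of_run hv' hv
      · exact hl ▸ eq_replicate_of_run hv hv'
      · exact (hvv rfl).elim
  · intro h i k
    obtain ⟨m, hm⟩ := factor_infix_of_period hn hx i k
    have main : ∀ v, factor x 0 n ∈ closedWords Γ v n → (∃ v v', run v (factor x i k) = some v') ∧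
        MotzkinAdmissible (dyck (factor x i k)) := by
      rintro v ⟨-, h1, h2⟩
      refine ⟨run_of_infix hm ⟨v, v, run_flatten_replicate h1 m⟩, ?_⟩
      have := h2.flatten_replicate m
      refine this.of_infix ?_
      have := hm.map (Attach.φ (S := Fin 2) (Γ := Γ) (Kneg := fun _ => 1) (Kpos := fun _ => 1))
      simpa [List.map_flatten] using this
    rcases h with (h | h) | h
    · exact main _ h
    · exact main _ h
    · rw [Set.mem_singleton_iff] at h
      have h0 : factor (fun _ => (sZero : EvenOddSymbol Γ)) 0 n = List.replicate n sZero :=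
        factor_const _ _ _
      have : x = fun _ => sZero :=
        eq_of_factor_eq_of_period hn hx (fun _ => rfl) (h.trans h0.symm)
      rw [this, factor_const]
      exact ⟨⟨.even, _, run_replicate_zero _ _⟩,
        (motzkinAdmissible_iff _).2 ⟨_, reduce_replicate_zero _⟩⟩

theorem finite_length_eq' [Finite Γ] (n : ℕ) :
    {w : List (EvenOddSymbol Γ) | w.length = n}.Finite := by
  have : Finite (EvenOddSymbol Γ) := by
    refine Finite.of_surjective (fun s : Fin 2 ⊕ (Γ ⊕ Γ) => match s with
      | .inl i => .base i
      | .inr (.inl γ) => sNeg γ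
      | .inr (.inr γ) => sPos γ) fun a => ?_
    rcases a.cases' with rfl | rfl | ⟨γ, rfl⟩ | ⟨γ, rfl⟩
    · exact ⟨.inl 0, rfl⟩
    · exact ⟨.inl 1, rfl⟩
    · exact ⟨.inr (.inl γ), rfl⟩
    · exact ⟨.inr (.inr γ), rfl⟩
  exact List.finite_length_eq _ n

theorem ncard_periodicPoints_eq {n : ℕ} (hn : 0 < n) :
    (periodicPoints (evenOddShift Γ).carrier n).ncard =
      (closedWords Γ .even n ∪ closedWords Γ .odd n ∪ {List.replicate n sZero}).ncard := by
  refine Set.ncard_congr (fun x _ => factor x 0 n) ?_ ?_ ?_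
  · intro x hx
    rw [mem_periodicPoints] at hx
    exact (mem_evenOddShift_iff_of_period hn hx.2).1 hx.1
  · intro x y hx hy h
    rw [mem_periodicPoints] at hx hy
    exact eq_of_factor_eq_of_period hn hx.2 hy.2 h
  · intro w hw
    have hl : w.length = n := by
      rcases hw with (hw | hw) | hw
      · exact hw.1
      · exact hw.1
      · rw [Set.mem_singleton_iff.1 hw, List.length_replicate]
    obtain ⟨x, hx, rfl⟩ := exists_period_factor_eq hn w hl
    exact ⟨x, mem_periodicPoints.2 ⟨(mem_evenOddShift_iff_of_period hn hx).2 hw, hx⟩, rfl⟩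

/-- For even n the word 0^n is counted at both vertices and one copy has to be removed; for odd n it
is counted at neither and has to be added. -/
theorem ncard_periodicPoints [Finite Γ] {n : ℕ} (hn : 0 < n) :
    ((periodicPoints (evenOddShift Γ).carrier n).ncard : ℝ) =
      (closedWords Γ .even n).ncard + (closedWords Γ .odd n).ncard + (-1) ^ (n + 1) := by
  have fe : (closedWords Γ .even n).Finite := (finite_length_eq' n).subset fun w hw => hw.1
  have fo : (closedWords Γ .odd n).Finite := (finite_length_eq' n).subset fun w hw => hw.1
  have hinter : ∀ w, w ∈ closedWords Γ .even n → w ∈ closedWords Γ .odd n →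
      w = List.replicate n sZero := fun w h1 h2 => by
    have := eq_replicate_of_run h1.2.1 h2.2.1
    rwa [h1.1] at this
  have hadd := Set.ncard_union_add_ncard_inter _ _ fe fo
  rw [ncard_periodicPoints_eq hn]
  rcases Nat.even_or_odd n with he | ho
  · have h0 : ∀ v, List.replicate n sZero ∈ closedWords Γ v n := fun v =>
      ⟨by simp, by simp [run_replicate_zero, he], _, _, reduce_replicate_zero n, trivial⟩
    have h1 : closedWords Γ .even n ∩ closedWords Γ .odd n = {List.replicate n sZero} := by
      ext w
      exact ⟨fun h => hinter w h.1 h.2, fun h => by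
        rw [Set.mem_singleton_iff.1 h]; exact ⟨h0 _, h0 _⟩⟩
    rw [h1, Set.ncard_singleton] at hadd
    rw [Set.union_eq_left.2 (Set.singleton_subset_iff.2 (.inl (h0 _))), (he.add_one).neg_one_pow]
    have : ((closedWords Γ .even n ∪ closedWords Γ .odd n).ncard : ℝ) + 1 =
      (closedWords Γ .even n).ncard + (closedWords Γ .odd n).ncard := by exact_mod_cast hadd
    linarith
  · have hodd : ¬ Even n := Nat.not_even_iff_odd.2 ho
    have h0 : ∀ v, List.replicate n sZero ∉ closedWords Γ v n := fun v h => by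
      have := h.2.1
      rw [run_replicate_zero] at this
      cases v <;> simp [hodd, EvenVertex.swap] at this
    have h1 : closedWords Γ .even n ∩ closedWords Γ .odd n = ∅ := by
      ext w
      simp only [Set.mem_inter_iff, Set.mem_empty_iff_false, iff_false, not_and]
      intro h h'
      exact h0 _ (hinter w h h' ▸ h)
    rw [h1, Set.ncard_empty] at hadd
    rw [Set.union_singleton, Set.ncard_insert_of_notMem (by simp [h0]) (fe.union fo),
      (ho.add_one).neg_one_pow]
    have : ((closedWords Γ .even n ∪ closedWords Γ .odd n).ncard : ℝ) =
      (closedWords Γ .even n).ncard + (closedWords Γ .odd n).ncard := by exact_mod_cast hadd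
    push_cast
    linarith


/-! ### Counting words -/

variable {Γ : Type*}

theorem ncard_words_succ [Fintype Γ] (p : List (EvenOddSymbol Γ) → Prop) (n : ℕ) :
    {w | w.length = n + 1 ∧ p w}.ncard =
      {w | w.length = n ∧ p (sZero :: w)}.ncard + {w | w.length = n ∧ p (sOne :: w)}.ncard +
      ∑ γ, {w | w.length = n ∧ p (sNeg γ :: w)}.ncard +
      ∑ γ, {w | w.length = n ∧ p (sPos γ :: w)}.ncard := by
  have hfin : ∀ q : List (EvenOddSymbol Γ) → Prop, {w | w.length = n ∧ q w}.Finite := fun q =>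
    (finite_length_eq' n).subset fun w hw => hw.1
  let S : EvenOddSymbol Γ → Set (List (EvenOddSymbol Γ)) := fun a =>
    List.cons a '' {w | w.length = n ∧ p (a :: w)}
  have hcard : ∀ a, (S a).ncard = {w | w.length = n ∧ p (a :: w)}.ncard := fun a =>
    Set.ncard_image_of_injective _ (List.cons_injective)
  have hSfin : ∀ a, (S a).Finite := fun a => (hfin _).image _
  have hdisj : ∀ a b, a ≠ b → Disjoint (S a) (S b) := fun a b hab => by
    rw [Set.disjoint_left]
    rintro _ ⟨w, -, rfl⟩ ⟨w', -, h⟩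
    exact hab (List.cons.inj h).1.symm
  have hunion : ∀ f : Γ → EvenOddSymbol Γ, f.Injective →
      (⋃ γ, S (f γ)).ncard = ∑ γ, {w | w.length = n ∧ p (f γ :: w)}.ncard := fun f hf => by
    rw [Set.ncard_iUnion_of_finite (fun γ => hSfin _) (fun γ γ' h => hdisj _ _ (hf.ne h)),
      finsum_eq_sum_of_fintype]
    simp only [hcard]
  have key : {w | w.length = n + 1 ∧ p w} =
      ((S sZero ∪ S sOne) ∪ ⋃ γ, S (sNeg γ)) ∪ ⋃ γ, S (sPos γ) := by
    ext w
    constructor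
    · rintro ⟨hl, hp⟩
      obtain ⟨a, w, rfl⟩ := List.exists_cons_of_length_eq_add_one hl
      have ha : a :: w ∈ S a := ⟨w, ⟨by simpa using hl, hp⟩, rfl⟩
      rcases a.cases' with rfl | rfl | ⟨γ, rfl⟩ | ⟨γ, rfl⟩
      · exact .inl (.inl (.inl ha))
      · exact .inl (.inl (.inr ha))
      · exact .inl (.inr (Set.mem_iUnion.2 ⟨γ, ha⟩))
      · exact .inr (Set.mem_iUnion.2 ⟨γ, ha⟩)
    · have : ∀ a, w ∈ S a → w.length = n + 1 ∧ p w := by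
        rintro a ⟨w, ⟨h1, h2⟩, rfl⟩
        exact ⟨by simp [h1], h2⟩
      rintro (((h | h) | h) | h)
      · exact this _ h
      · exact this _ h
      · exact this _ (Set.mem_iUnion.1 h).choose_spec
      · exact this _ (Set.mem_iUnion.1 h).choose_spec
  have f3 : (⋃ γ, S (sNeg γ)).Finite := Set.finite_iUnion fun γ => hSfin _
  have f4 : (⋃ γ, S (sPos γ)).Finite := Set.finite_iUnion fun γ => hSfin _
  have f2 := (hSfin sZero).union (hSfin sOne)
  rw [key, Set.ncard_union_eq _ (f2.union f3) f4, Set.ncard_union_eq _ f2 f3,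
    Set.ncard_union_eq (hdisj _ _ (by simp)) (hSfin _) (hSfin _), hcard, hcard,
    hunion sNeg fun a b h => by simpa using h, hunion sPos fun a b h => by simpa using h]
  · simp only [Set.disjoint_union_left, Set.disjoint_iUnion_right]
    exact fun γ => ⟨hdisj _ _ (by simp), hdisj _ _ (by simp)⟩
  · simp only [Set.disjoint_union_left, Set.disjoint_iUnion_right, Set.disjoint_iUnion_left]
    exact fun γ => ⟨⟨hdisj _ _ (by simp), hdisj _ _ (by simp)⟩, fun γ' => hdisj _ _ (by simp)⟩

section pathSum

variable [Fintype Γ]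

/-- The sum of `F w * ε v` over the words `w` of length `n` that label a path from `u` to `v`. -/
def pathSum (ε : EvenVertex → ℝ) : ℕ → EvenVertex → (List (EvenOddSymbol Γ) → ℝ) → ℝ
  | 0, u, F => ε u * F []
  | n + 1, .even, F => pathSum ε n .odd (fun w => F (sZero :: w)) +
      pathSum ε n .even (fun w => F (sOne :: w))
  | n + 1, .odd, F => pathSum ε n .even (fun w => F (sZero :: w)) +
      ∑ γ, pathSum ε n .odd (fun w => F (sNeg γ :: w)) +
      ∑ γ, pathSum ε n .odd (fun w => F (sPos γ :: w))

open Classical in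
-- The set T of end vertices serves two counts: a singleton for closed words, everything for the
-- words of the language.
theorem ncard_eq_pathSum (T : Set EvenVertex) (n : ℕ) (u : EvenVertex)
    (p : List (EvenOddSymbol Γ) → Prop) :
    ({w | w.length = n ∧ (∃ v ∈ T, run u w = some v) ∧ p w}.ncard : ℝ) =
      pathSum (fun v => if v ∈ T then 1 else 0) n u (fun w => if p w then 1 else 0) := by
  induction n generalizing u p with
  | zero =>
    have : {w : List (EvenOddSymbol Γ) | w.length = 0 ∧ (∃ v ∈ T, run u w = some v) ∧ p w} =
        if u ∈ T ∧ p [] then {[]} else ∅ := by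
      ext w
      by_cases h : w = []
      · subst h
        by_cases h1 : u ∈ T <;> by_cases h2 : p [] <;> simp [run, h1, h2]
      · by_cases h1 : u ∈ T ∧ p [] <;> simp [h, h1]
    rw [this]
    by_cases h1 : u ∈ T <;> by_cases h2 : p [] <;> simp [pathSum, h1, h2]
  | succ n ih =>
    rw [ncard_words_succ]
    push_cast
    cases u with
    | even =>
      simp only [pathSum, ← ih]
      simp [run, step]
    | odd =>
      simp only [pathSum, ← ih]
      simp [run, step]

theorem pathSum_add (ε : EvenVertex → ℝ) (n : ℕ) (u : EvenVertex)
    (F G : List (EvenOddSymbol Γ) → ℝ) :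
    pathSum ε n u (fun w => F w + G w) = pathSum ε n u F + pathSum ε n u G := by
  induction n generalizing u F G with
  | zero => simp [pathSum, mul_add]
  | succ n ih =>
    cases u
    · simp only [pathSum, ih]; ring
    · simp only [pathSum, ih, Finset.sum_add_distrib]; ring

theorem pathSum_sum {ι : Type*} (s : Finset ι) (ε : EvenVertex → ℝ) (n : ℕ) (u : EvenVertex)
    (F : ι → List (EvenOddSymbol Γ) → ℝ) :
    pathSum ε n u (fun w => ∑ i ∈ s, F i w) = ∑ i ∈ s, pathSum ε n u (F i) := by
  classical
  induction s using Finset.induction_on with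
  | empty =>
    simp only [Finset.sum_empty]
    have := pathSum_add ε n u (fun _ : List (EvenOddSymbol Γ) => (0 : ℝ)) (fun _ => 0)
    simp only [add_zero] at this
    linarith
  | insert a s ha ih => simp only [Finset.sum_insert ha, pathSum_add, ih]

/-- The sum of a function over all words that arise from a word over the alphabet with only one
pair of brackets by a choice of indices for its brackets. -/
def labelSum : List (EvenOddSymbol Unit) → (List (EvenOddSymbol Γ) → ℝ) → ℝ
  | [], F => F []
  | .base i :: s, F => labelSum s (fun w => F (.base i :: w))
  | .neg _ _ :: s, F => ∑ γ, labelSum s (fun w => F (sNeg γ :: w))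
  | .pos _ _ :: s, F => ∑ γ, labelSum s (fun w => F (sPos γ :: w))

/-- The automaton does not see the indices of the brackets, so the shape of the word can be summed
over separately from its indexing. -/
theorem pathSum_eq_pathSum_labelSum (ε : EvenVertex → ℝ) (n : ℕ) (u : EvenVertex)
    (F : List (EvenOddSymbol Γ) → ℝ) :
    pathSum ε n u F = pathSum ε n u (fun s : List (EvenOddSymbol Unit) => labelSum s F) := by
  induction n generalizing u F with
  | zero => simp [pathSum, labelSum]
  | succ n ih =>
    cases u
    · simp only [pathSum, labelSum, ← ih]
    · simp only [pathSum, labelSum, pathSum_sum, ← ih, Finset.univ_unique, Finset.sum_singleton]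

/-- The sum of a function over all lists of a given length. -/
def listSum : ℕ → (List Γ → ℝ) → ℝ
  | 0, f => f []
  | p + 1, f => ∑ γ, listSum p (fun l => f (γ :: l))

/-- Needed because `reduceStep` appends a new unmatched opening bracket at the end of its list. -/
theorem listSum_succ_concat (p : ℕ) (f : List Γ → ℝ) :
    listSum (p + 1) f = ∑ γ, listSum p (fun l => f (l ++ [γ])) := by
  induction p generalizing f with
  | zero => rfl
  | succ p ih =>
    calc listSum (p + 1 + 1) f = ∑ x, ∑ y, listSum p fun l => f (x :: (l ++ [y])) :=
          Finset.sum_congr rfl fun x _ => ih _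
      _ = ∑ y, ∑ x, listSum p fun l => f (x :: (l ++ [y])) := Finset.sum_comm

theorem listSum_const (p : ℕ) (c : ℝ) :
    listSum p (fun _ : List Γ => c) = (Fintype.card Γ : ℝ) ^ p * c := by
  induction p with
  | zero => simp [listSum]
  | succ p ih => simp [listSum, ih, pow_succ']; ring

open Classical in
-- The longer list is free and determines the shorter one as its prefix.
theorem listSum_compatible (p q : ℕ) :
    listSum p (fun P : List Γ => listSum q fun Q : List Γ => if Compatible P Q then (1 : ℝ) else 0) =
      (Fintype.card Γ : ℝ) ^ max p q := by
  induction p generalizing q with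
  | zero => simp [listSum, Compatible, listSum_const]
  | succ p ih =>
    cases q with
    | zero =>
      have : ∀ P : List Γ, Compatible P [] := fun P => by cases P <;> trivial
      simp [this, listSum, listSum_const, pow_succ']
    | succ q =>
      have h0 : ∀ a : Γ, listSum p (fun P : List Γ => ∑ b : Γ, listSum q fun Q : List Γ =>
          if Compatible (a :: P) (b :: Q) then (1 : ℝ) else 0) =
          (Fintype.card Γ : ℝ) ^ max p q := fun a => by
        rw [← ih]
        congr 1
        funext P
        rw [Finset.sum_eq_single a]
        · simp [Compatible]
        · intro b _ hb
          simp [Compatible, Ne.symm hb, listSum_const]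
        · simp
      simp only [listSum, h0]
      rw [Nat.succ_max_succ]
      simp [pow_succ']

end pathSum

/-! ### Bracket statistics -/

/-- The number of unmatched closing brackets, of unmatched opening brackets, and of matched
pairs. -/
def profile : List (EvenOddSymbol Unit) → ℕ × ℕ × ℕ
  | [] => (0, 0, 0)
  | .base _ :: s => profile s
  | .pos _ _ :: s => ((profile s).1 + 1, (profile s).2)
  | .neg _ _ :: s => match profile s with
    | (0, q, k) => (0, q + 1, k)
    | (p + 1, q, k) => (p, q, k + 1)

/-- The number of opening brackets. -/
def openCount : List (EvenOddSymbol Unit) → ℕ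
  | [] => 0
  | .base _ :: s => openCount s
  | .pos _ _ :: s => openCount s
  | .neg _ _ :: s => openCount s + 1

/-- The number of closing brackets. -/
def closeCount : List (EvenOddSymbol Unit) → ℕ
  | [] => 0
  | .base _ :: s => closeCount s
  | .pos _ _ :: s => closeCount s + 1
  | .neg _ _ :: s => closeCount s

theorem profile_count (s : List (EvenOddSymbol Unit)) :
    (profile s).2.1 + (profile s).2.2 = openCount s ∧
      (profile s).1 + (profile s).2.2 = closeCount s := by
  induction s with
  | nil => simp [profile, openCount, closeCount]
  | cons a s ih =>
    rcases a with _ | _ | _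
    · exact ih
    · simp only [profile, openCount, closeCount]
      rcases h : profile s with ⟨_ | p, q, k⟩ <;> simp only [h] at ih ⊢ <;> omega
    · simp only [profile, openCount, closeCount]
      omega

open Classical in
-- The two indices of a matched pair must agree, which leaves one factor N per pair; mismatches
-- contribute `Θ none = 0`. The indices of the unmatched brackets are free and form the lists P and
-- Q.
theorem labelSum_reduce [Fintype Γ] (s : List (EvenOddSymbol Unit))
    (Θ : Option (List Γ × List Γ) → ℝ) (hΘ : Θ none = 0) :
    labelSum s (fun w => Θ (reduce (dyck w))) = (Fintype.card Γ : ℝ) ^ (profile s).2.2 *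
      listSum (profile s).1 fun P => listSum (profile s).2.1 fun Q => Θ (some (P, Q)) := by
  have hcons : ∀ (a : EvenOddSymbol Γ) (w : List (EvenOddSymbol Γ)),
    reduce (dyck (a :: w)) = (reduce (dyck w)).bind (reduceStep a.φ) := fun _ _ => rfl
  induction s generalizing Θ with
  | nil => simp [labelSum, profile, listSum, reduce]
  | cons a s ih =>
    rcases a with i | _ | _
    · simp only [labelSum, profile, hcons]
      rw [ih (fun x => Θ (x.bind (reduceStep (Attach.base i : EvenOddSymbol Γ).φ))) hΘ]
      rfl
    · simp only [labelSum, hcons]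
      rw [Finset.sum_congr rfl fun γ _ =>
        ih (fun x => Θ (x.bind (reduceStep (sNeg γ : EvenOddSymbol Γ).φ))) hΘ]
      rw [← Finset.mul_sum]
      rcases h : profile s with ⟨_ | p, q, k⟩
      · simp only [profile, h]
        change _ = _ * listSum (q + 1) fun Q => Θ (some ([], Q))
        rw [listSum_succ_concat]
        rfl
      · simp only [profile, h, listSum, Option.bind_some]
        rw [pow_succ, mul_assoc]
        congr 1
        have h0 : ∀ γ δ : Γ, (listSum p fun P => listSum q fun Q =>
            Θ (reduceStep (sNeg γ : EvenOddSymbol Γ).φ (δ :: P, Q))) = if δ = γ then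
            listSum p fun P => listSum q fun Q => Θ (some (P, Q)) else 0 := fun γ δ => by
          by_cases hd : δ = γ
          · simp [Attach.φ, reduceStep, hd]
          · simp [Attach.φ, reduceStep, hd, hΘ, listSum_const]
        simp only [h0]
        simp
    · simp only [labelSum, hcons]
      rw [Finset.sum_congr rfl fun γ _ =>
        ih (fun x => Θ (x.bind (reduceStep (sPos γ : EvenOddSymbol Γ).φ))) hΘ]
      rw [← Finset.mul_sum]
      rfl

open Classical in
-- With k matched pairs and p, q unmatched brackets the count is N^k N^max(p,q), and k + max(p,q) is
-- the maximum of the two bracket totals.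
theorem labelSum_cyclicallyAdmissible [Fintype Γ] (s : List (EvenOddSymbol Unit)) :
    labelSum s (fun w : List (EvenOddSymbol Γ) =>
      if CyclicallyAdmissible (dyck w) then (1 : ℝ) else 0) =
      (Fintype.card Γ : ℝ) ^ max (openCount s) (closeCount s) := by
  have := labelSum_reduce (Γ := Γ) s
    (fun x => if ∃ P Q, x = some (P, Q) ∧ Compatible P Q then 1 else 0) (by simp)
  refine this.trans ?_
  simp only [Option.some.injEq, Prod.mk.injEq]
  have h : ∀ P Q : List Γ, (∃ P' Q', (P = P' ∧ Q = Q') ∧ Compatible P' Q') ↔ Compatible P Q :=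
    fun P Q => ⟨by rintro ⟨_, _, ⟨rfl, rfl⟩, h⟩; exact h, fun h => ⟨P, Q, ⟨rfl, rfl⟩, h⟩⟩
  simp only [h, listSum_compatible]
  rw [← pow_add]
  congr 1
  have := profile_count s
  omega

open Classical in
theorem labelSum_motzkinAdmissible [Fintype Γ] (s : List (EvenOddSymbol Unit)) :
    labelSum s (fun w : List (EvenOddSymbol Γ) =>
      if MotzkinAdmissible (dyck w) then (1 : ℝ) else 0) =
      (Fintype.card Γ : ℝ) ^ ((profile s).1 + (profile s).2.1 + (profile s).2.2) := by
  simp only [motzkinAdmissible_iff]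
  have := labelSum_reduce (Γ := Γ) s (fun x => if ∃ y, x = some y then 1 else 0) (by simp)
  refine this.trans ?_
  simp [listSum_const, pow_add]
  ring

open Classical in
theorem ncard_closedWords [Fintype Γ] (v : EvenVertex) (n : ℕ) :
    ((closedWords Γ v n).ncard : ℝ) = pathSum (fun u => if u = v then 1 else 0) n v
      fun s : List (EvenOddSymbol Unit) =>
        (Fintype.card Γ : ℝ) ^ max (openCount s) (closeCount s) := by
  have := ncard_eq_pathSum (Γ := Γ) {v} n v fun w => CyclicallyAdmissible (dyck w)
  simp only [Set.mem_singleton_iff, exists_eq_left] at this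
  rw [closedWords, this, pathSum_eq_pathSum_labelSum]
  simp only [labelSum_cyclicallyAdmissible]


/-! ### The transfer operator -/

/-- The operator `f ↦ f(· + 1, ·) + f(·, · + 1)`. -/
def sigma (R : Type*) [CommSemiring R] : Module.End R (ℕ → ℕ → R) where
  toFun f j k := f (j + 1) k + f j (k + 1)
  map_add' f g := by funext j k; simp only [Pi.add_apply]; ring
  map_smul' c f := by funext j k; simp [mul_add]

theorem sigma_apply {R : Type*} [CommSemiring R] (f : ℕ → ℕ → R) (j k : ℕ) :
    sigma R f j k = f (j + 1) k + f j (k + 1) := rfl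

theorem sigma_mono {f g : ℕ → ℕ → ℝ} (h : ∀ j k, f j k ≤ g j k) (j k : ℕ) :
    sigma ℝ f j k ≤ sigma ℝ g j k := add_le_add (h _ _) (h _ _)

theorem sigma_pow_mono {f g : ℕ → ℕ → ℝ} (h : ∀ j k, f j k ≤ g j k) (m j k : ℕ) :
    (sigma ℝ ^ m) f j k ≤ (sigma ℝ ^ m) g j k := by
  induction m generalizing f g with
  | zero => exact h j k
  | succ m ih =>
    rw [pow_succ, Module.End.mul_apply, Module.End.mul_apply]
    exact ih fun j k => sigma_mono h j k

theorem sigma_pow_nonneg {f : ℕ → ℕ → ℝ} (h : ∀ j k, 0 ≤ f j k) (m j k : ℕ) :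
    0 ≤ (sigma ℝ ^ m) f j k := by
  have := sigma_pow_mono (f := 0) h m j k
  simpa using this

theorem sigma_pow_eigen {f : ℕ → ℕ → ℝ} {c : ℝ} (h : sigma ℝ f = c • f) (m : ℕ) :
    (sigma ℝ ^ m) f = c ^ m • f := by
  induction m with
  | zero => simp
  | succ m ih => rw [pow_succ', Module.End.mul_apply, ih, map_smul, h, smul_smul, pow_succ]

theorem sigma_ofReal (f : ℕ → ℕ → ℝ) (m j k : ℕ) :
    (sigma ℂ ^ m) (fun j k => (f j k : ℂ)) j k = ((sigma ℝ ^ m) f j k : ℂ) := by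
  induction m generalizing j k with
  | zero => rfl
  | succ m ih =>
    rw [pow_succ', pow_succ', Module.End.mul_apply, Module.End.mul_apply, sigma_apply, sigma_apply,
      ih, ih]
    push_cast
    rfl

theorem norm_sigma_pow_le {f : ℕ → ℕ → ℂ} {g : ℕ → ℕ → ℝ} (h : ∀ j k, ‖f j k‖ ≤ g j k)
    (m j k : ℕ) : ‖(sigma ℂ ^ m) f j k‖ ≤ (sigma ℝ ^ m) g j k := by
  induction m generalizing f g with
  | zero => exact h j k
  | succ m ih =>
    rw [pow_succ, pow_succ, Module.End.mul_apply, Module.End.mul_apply]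
    exact ih fun j k => (norm_add_le _ _).trans (add_le_add (h _ _) (h _ _))

open Classical in
/-- The entry `(u, v)` of the `n`-th power of the matrix `!![1, 1; 1, sigma]`. -/
noncomputable def transfer : ℕ → EvenVertex → EvenVertex → (ℕ → ℕ → ℝ) → ℕ → ℕ → ℝ
  | 0, u, v, f => if u = v then f else 0
  | n + 1, .even, v, f => transfer n .odd v f + transfer n .even v f
  | n + 1, .odd, v, f => transfer n .even v f + sigma ℝ (transfer n .odd v f)

open Classical in
-- The offsets j and k make the induction work: reading a bracket raises one of them, and the two
-- kinds of bracket together give `sigma`.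
theorem pathSum_eq_transfer (f : ℕ → ℕ → ℝ) (v : EvenVertex) (n : ℕ) (u : EvenVertex) (j k : ℕ) :
    pathSum (fun u => if u = v then 1 else 0) n u
      (fun s : List (EvenOddSymbol Unit) => f (j + openCount s) (k + closeCount s)) =
      transfer n u v f j k := by
  induction n generalizing u j k with
  | zero =>
    by_cases h : u = v
    · simp [pathSum, transfer, openCount, closeCount, h]
    · simp [pathSum, transfer, h]
  | succ n ih =>
    cases u with
    | even => simp only [pathSum, transfer, openCount, closeCount, ih, Pi.add_apply]
    | odd =>
      simp only [pathSum, transfer, openCount, closeCount, ih, Pi.add_apply, sigma_apply,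
        Finset.univ_unique, Finset.sum_singleton]
      rw [← ih .odd (j + 1) k, ← ih .odd j (k + 1)]
      simp only [add_assoc, add_comm (1 : ℕ)]

/-- The trace of the `n`-th power of the matrix `!![1, 1; 1, sigma]`. -/
noncomputable def transferTrace (n : ℕ) (f : ℕ → ℕ → ℝ) : ℕ → ℕ → ℝ :=
  transfer n .even .even f + transfer n .odd .odd f

theorem transferTrace_zero (f : ℕ → ℕ → ℝ) : transferTrace 0 f = f + f := by
  simp [transferTrace, transfer]

theorem transferTrace_one (f : ℕ → ℕ → ℝ) : transferTrace 1 f = f + sigma ℝ f := by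
  simp [transferTrace, transfer]

/-- Cayley-Hamilton for a matrix of trace 1 + σ and determinant σ - 1. -/
theorem transferTrace_add_two (n : ℕ) (f : ℕ → ℕ → ℝ) :
    transferTrace (n + 2) f = transferTrace (n + 1) f + sigma ℝ (transferTrace (n + 1) f) -
      sigma ℝ (transferTrace n f) + transferTrace n f := by
  simp only [transferTrace, transfer, map_add]
  abel

theorem transfer_mono {f g : ℕ → ℕ → ℝ} (h : ∀ j k, f j k ≤ g j k) (n : ℕ) (u v : EvenVertex)
    (j k : ℕ) : transfer n u v f j k ≤ transfer n u v g j k := by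
  induction n generalizing u j k with
  | zero =>
    by_cases huv : u = v
    · simp [transfer, huv, h]
    · simp [transfer, huv]
  | succ n ih =>
    cases u with
    | even => exact add_le_add (ih _ _ _) (ih _ _ _)
    | odd => exact add_le_add (ih _ _ _) (sigma_mono (fun j k => ih _ j k) _ _)

theorem transferTrace_mono {f g : ℕ → ℕ → ℝ} (h : ∀ j k, f j k ≤ g j k) (n j k : ℕ) :
    transferTrace n f j k ≤ transferTrace n g j k :=
  add_le_add (transfer_mono h n _ _ _ _) (transfer_mono h n _ _ _ _)

/-- On such f the matrix becomes [[1,1],[1,N+1]], with eigenvalues l and N + 2 - l. -/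
theorem transferTrace_eigen {f : ℕ → ℕ → ℝ} {N l : ℝ} (h : sigma ℝ f = (N + 1) • f)
    (hl : l ^ 2 - (N + 2) * l + N = 0) (n : ℕ) :
    transferTrace n f = (l ^ n + (N + 2 - l) ^ n) • f := by
  induction n using Nat.twoStepInduction with
  | zero => rw [transferTrace_zero]; funext j k; simp; ring
  | one => rw [transferTrace_one, h]; funext j k; simp; ring
  | more n ih1 ih2 =>
    rw [transferTrace_add_two, ih1, ih2, map_smul, map_smul, h]
    funext j k
    simp only [Pi.add_apply, Pi.sub_apply, Pi.smul_apply, smul_eq_mul, pow_succ]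
    linear_combination (-f j k * (l ^ n + (N + 2 - l) ^ n)) * hl

/-! ### Weights -/

/-- The weight `N ^ max j k`. -/
def maxPow (N : ℝ) (j k : ℕ) : ℝ := N ^ max j k

/-- The weight `N ^ j` on the diagonal. -/
def diagPow (N : ℝ) (j k : ℕ) : ℝ := if j = k then N ^ j else 0

/-- Off the diagonal exactly one of the two shifts raises the maximum; on the diagonal both do,
which gives 2N instead of N + 1. -/
theorem sigma_maxPow (N : ℝ) :
    sigma ℝ (maxPow N) = (N + 1) • maxPow N + (N - 1) • diagPow N := by
  funext j k
  simp only [sigma_apply, maxPow, diagPow, Pi.add_apply, Pi.smul_apply, smul_eq_mul]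
  rcases lt_trichotomy j k with h | rfl | h
  · rw [max_eq_right (by omega), max_eq_right (by omega), max_eq_right (by omega),
      if_neg h.ne, pow_succ]
    ring
  · rw [max_eq_left (by omega), max_eq_right (by omega), max_self, if_pos rfl, pow_succ]
    ring
  · rw [max_eq_left (by omega), max_eq_left (by omega), max_eq_left (by omega),
      if_neg h.ne', pow_succ]
    ring

theorem sigma_pow_left (N : ℝ) :
    sigma ℝ (fun j _ => N ^ j) = (N + 1) • (fun j _ => N ^ j : ℕ → ℕ → ℝ) := by
  funext j k
  simp only [sigma_apply, Pi.smul_apply, smul_eq_mul, pow_succ]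
  ring

theorem sigma_pow_add_pow (N : ℝ) :
    sigma ℝ (fun j k => N ^ j + N ^ k) = (N + 1) • (fun j k => N ^ j + N ^ k : ℕ → ℕ → ℝ) := by
  funext j k
  simp only [sigma_apply, Pi.smul_apply, smul_eq_mul, pow_succ]
  ring

section bounds

variable {N : ℝ} (hN : 1 ≤ N)
include hN

theorem maxPow_le (j k : ℕ) : maxPow N j k ≤ N ^ j + N ^ k := by
  rw [maxPow]
  rcases max_choice j k with h | h <;> rw [h]
  · have : 0 ≤ N ^ k := by positivity
    linarith
  · have : 0 ≤ N ^ j := by positivity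
    linarith

theorem pow_le_maxPow (j k : ℕ) : N ^ j ≤ maxPow N j k :=
  pow_le_pow_right₀ hN (le_max_left _ _)

theorem maxPow_nonneg (j k : ℕ) : 0 ≤ maxPow N j k := by
  rw [maxPow]; positivity

theorem diagPow_nonneg (j k : ℕ) : 0 ≤ diagPow N j k := by
  rw [diagPow]; split_ifs <;> positivity

theorem diagPow_le_maxPow (j k : ℕ) : diagPow N j k ≤ maxPow N j k := by
  rw [diagPow]
  split_ifs
  · exact pow_le_maxPow hN j k
  · exact maxPow_nonneg hN j k

end bounds

/-- The value of `sigma ^ k * trace (!![1, 1; 1, sigma] ^ n)` on `maxPow N` at `(0, 0)`. -/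
noncomputable def traceCoeff (N : ℝ) (k n : ℕ) : ℝ :=
  (sigma ℝ ^ k) (transferTrace n (maxPow N)) 0 0

/-- The value of `sigma ^ k` on `maxPow N` at `(0, 0)`. -/
noncomputable def maxCoeff (N : ℝ) (k : ℕ) : ℝ := (sigma ℝ ^ k) (maxPow N) 0 0

/-- The value of `sigma ^ k` on `diagPow N` at `(0, 0)`. -/
noncomputable def diagCoeff (N : ℝ) (k : ℕ) : ℝ := (sigma ℝ ^ k) (diagPow N) 0 0

theorem maxCoeff_zero (N : ℝ) : maxCoeff N 0 = 1 := by simp [maxCoeff, maxPow]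

theorem maxCoeff_succ (N : ℝ) (k : ℕ) :
    maxCoeff N (k + 1) = (N + 1) * maxCoeff N k + (N - 1) * diagCoeff N k := by
  rw [maxCoeff, pow_succ, Module.End.mul_apply, sigma_maxPow, map_add, map_smul, map_smul]
  rfl

theorem sigma_pow_sigma (f : ℕ → ℕ → ℝ) (k : ℕ) :
    (sigma ℝ ^ k) (sigma ℝ f) = (sigma ℝ ^ (k + 1)) f := by
  rw [pow_succ, Module.End.mul_apply]

theorem traceCoeff_zero (N : ℝ) (k : ℕ) : traceCoeff N k 0 = 2 * maxCoeff N k := by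
  rw [traceCoeff, transferTrace_zero, map_add, maxCoeff, two_mul]
  rfl

theorem traceCoeff_one (N : ℝ) (k : ℕ) :
    traceCoeff N k 1 = maxCoeff N k + maxCoeff N (k + 1) := by
  rw [traceCoeff, transferTrace_one, map_add, sigma_pow_sigma]
  rfl

theorem traceCoeff_add_two (N : ℝ) (k n : ℕ) :
    traceCoeff N k (n + 2) = traceCoeff N k (n + 1) + traceCoeff N (k + 1) (n + 1) -
      traceCoeff N (k + 1) n + traceCoeff N k n := by
  rw [traceCoeff, transferTrace_add_two, map_add, map_sub, map_add, sigma_pow_sigma,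
    sigma_pow_sigma]
  rfl

section bounds

variable {N l : ℝ} (hN : 1 ≤ N)
include hN

theorem traceCoeff_nonneg (k n : ℕ) : 0 ≤ traceCoeff N k n := by
  refine sigma_pow_nonneg (fun j k => ?_) k 0 0
  have h0 : transferTrace n (0 : ℕ → ℕ → ℝ) = 0 := by
    have := transferTrace_eigen (f := 0) (N := 0) (l := 0) (by simp) (by simp) n
    simpa using this
  have := transferTrace_mono (f := 0) (fun j k => maxPow_nonneg hN j k) n j k
  simpa [h0] using this

theorem traceCoeff_le (hl : l ^ 2 - (N + 2) * l + N = 0) (k n : ℕ) :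
    traceCoeff N k n ≤ 2 * ((N + 1) ^ k * (l ^ n + (N + 2 - l) ^ n)) := by
  have h := sigma_pow_mono (fun j k => transferTrace_mono (maxPow_le hN) n j k) k 0 0
  rw [transferTrace_eigen (sigma_pow_add_pow N) hl, map_smul,
    sigma_pow_eigen (sigma_pow_add_pow N)] at h
  refine h.trans (le_of_eq ?_)
  simp only [Pi.smul_apply, smul_eq_mul, pow_zero]
  ring

theorem le_traceCoeff (hl : l ^ 2 - (N + 2) * l + N = 0) (n : ℕ) :
    l ^ n + (N + 2 - l) ^ n ≤ traceCoeff N 0 n := by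
  have h := transferTrace_mono (pow_le_maxPow hN) n 0 0
  rw [transferTrace_eigen (sigma_pow_left N) hl] at h
  simpa [traceCoeff] using h

theorem maxCoeff_nonneg (k : ℕ) : 0 ≤ maxCoeff N k :=
  sigma_pow_nonneg (maxPow_nonneg hN) k 0 0

theorem maxCoeff_le (k : ℕ) : maxCoeff N k ≤ 2 * (N + 1) ^ k := by
  have h := sigma_pow_mono (maxPow_le hN) k 0 0
  rw [sigma_pow_eigen (sigma_pow_add_pow N)] at h
  refine h.trans (le_of_eq ?_)
  simp only [Pi.smul_apply, smul_eq_mul, pow_zero]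
  ring

theorem diagCoeff_nonneg (k : ℕ) : 0 ≤ diagCoeff N k :=
  sigma_pow_nonneg (diagPow_nonneg hN) k 0 0

theorem diagCoeff_le (k : ℕ) : diagCoeff N k ≤ maxCoeff N k :=
  sigma_pow_mono (diagPow_le_maxPow hN) k 0 0

end bounds

theorem ncard_periodicPoints_eq_traceCoeff {Γ : Type*} [Fintype Γ] {n : ℕ} (hn : 0 < n) :
    ((periodicPoints (evenOddShift Γ).carrier n).ncard : ℝ) =
      traceCoeff (Fintype.card Γ) 0 n + (-1) ^ (n + 1) := by
  rw [ncard_periodicPoints hn, ncard_closedWords, ncard_closedWords]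
  have h := fun v => pathSum_eq_transfer (maxPow (Fintype.card Γ)) v n v 0 0
  simp only [maxPow, zero_add] at h
  rw [h, h]
  rfl


open Filter Topology

/-! ### Generating functions -/

/-- Iteration of an affine recursion with geometric ratio. -/
theorem eq_of_hasSum_of_recursion {x β : ℕ → ℂ} {v s : ℂ} {C R : ℝ}
    (h : ∀ k, x k = v * x (k + 1) + β k) (hx : ∀ k, ‖x k‖ ≤ C * R ^ k) (hv : ‖v‖ * R < 1)
    (hR : 0 ≤ R) (hs : HasSum (fun k => v ^ k * β k) s) : x 0 = s := by
  have h1 : ∀ K, x 0 = (∑ k ∈ Finset.range K, v ^ k * β k) + v ^ K * x K := fun K => by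
    induction K with
    | zero => simp
    | succ K ih =>
      rw [ih, Finset.sum_range_succ, h K]
      ring
  have h2 : Tendsto (fun K => v ^ K * x K) atTop (𝓝 0) := by
    have h3 : Tendsto (fun K => C * (‖v‖ * R) ^ K) atTop (𝓝 0) := by
      simpa using (tendsto_pow_atTop_nhds_zero_of_lt_one (by positivity) hv).const_mul C
    refine squeeze_zero_norm (fun K => ?_) h3
    rw [norm_mul, norm_pow, mul_pow]
    calc ‖v‖ ^ K * ‖x K‖ ≤ ‖v‖ ^ K * (C * R ^ K) := by gcongr; exact hx K
      _ = _ := by ring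
  have h4 := hs.tendsto_sum_nat.add h2
  rw [add_zero] at h4
  exact tendsto_nhds_unique (tendsto_const_nhds.congr fun K => h1 K) h4

theorem summable_of_le_pow {a : ℕ → ℝ} {v : ℂ} {C R : ℝ} (h0 : ∀ k, 0 ≤ a k)
    (h : ∀ k, a k ≤ C * R ^ k) (hR : 0 ≤ R) (hv : ‖v‖ * R < 1) :
    Summable fun k => (a k : ℂ) * v ^ k := by
  refine Summable.of_norm_bounded
    ((summable_geometric_of_lt_one (by positivity) hv).mul_left C) fun k => ?_
  rw [norm_mul, norm_pow, Complex.norm_real, Real.norm_of_nonneg (h0 k), mul_pow]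
  calc a k * ‖v‖ ^ k ≤ C * R ^ k * ‖v‖ ^ k := by gcongr; exact h k
    _ = _ := by ring

section

variable {N : ℝ} {v r : ℂ} (hN : 2 ≤ N) (hv : ‖v‖ * (N + 1) < 1)
  (hr : r ^ 2 = 1 - 4 * N * v ^ 2) (hre : 0 < r.re)
include hN hv hr hre

/-- The sum is the value at (0,0) of the resolvent (1 - vσ)⁻¹ applied to `diagPow N`. An explicit
solution ψ of ψ = diagPow + vσψ is exhibited, and iterating that equation expands ψ(0,0) = 1/r into
the series. -/
theorem hasSum_diagCoeff : HasSum (fun k => (diagCoeff N k : ℂ) * v ^ k) (1 / r) := by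
  have hN1 : 1 ≤ N := by linarith
  have hr0 : r ≠ 0 := fun h => by simp [h] at hre
  have hr1 : 1 + r ≠ 0 := fun h => by
    have := congrArg Complex.re h
    simp at this
    linarith
  -- The root of vβ² - β + vN = 0 that tends to 0 with v, written so that v = 0 needs no separate
  -- case.
  obtain ⟨β, hβ⟩ : ∃ β, β = 2 * N * v / (1 + r) := ⟨_, rfl⟩
  have hβ1 : β = v * (β ^ 2 + N) := by
    rw [hβ]
    field_simp
    linear_combination (-N * v) * hr
  have hβ2 : 1 = r + 2 * v * β := by
    rw [hβ]
    field_simp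
    linear_combination (-1 : ℂ) * hr
  -- This bound lets N^j + N^k dominate ψ up to a constant, so the remainder after m iterations is
  -- of order (|v|(N+1))^m.
  have hβN : ‖β‖ ≤ N := by
    have h1 : 1 ≤ ‖1 + r‖ := by
      refine le_trans ?_ (Complex.re_le_norm _)
      simp
      exact hre.le
    rw [hβ, norm_div, norm_mul, norm_mul, Complex.norm_real, Real.norm_of_nonneg (by linarith),
      div_le_iff₀ (by linarith)]
    have h2 : ‖v‖ * N < 1 := by nlinarith [norm_nonneg v]
    have h3 : ‖(2 : ℂ)‖ = 2 := by simp
    rw [h3]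
    nlinarith
  -- The ansatz is N^min(j,k) β^|j-k|. Off the diagonal the equation reduces to the quadratic for β;
  -- on the diagonal it fixes the prefactor 1/r.
  obtain ⟨ψ, hψ⟩ : ∃ ψ : ℕ → ℕ → ℂ, ψ = fun j k =>
      1 / r * if k ≤ j then (N : ℂ) ^ k * β ^ (j - k) else (N : ℂ) ^ j * β ^ (k - j) := ⟨_, rfl⟩
  have hsig : ψ = (fun j k => (diagPow N j k : ℂ)) + v • sigma ℂ ψ := by
    funext j k
    simp only [Pi.add_apply, Pi.smul_apply, smul_eq_mul, sigma_apply, hψ, diagPow]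
    rcases lt_trichotomy j k with h | rfl | h
    · obtain ⟨d, rfl⟩ := Nat.exists_eq_add_of_lt h
      have e0 : (if j + d + 1 ≤ j + 1 then (N : ℂ) ^ (j + d + 1) * β ^ (j + 1 - (j + d + 1))
          else (N : ℂ) ^ (j + 1) * β ^ (j + d + 1 - (j + 1))) = (N : ℂ) ^ (j + 1) * β ^ d := by
        split_ifs with h
        · have : d = 0 := by omega
          simp [this]
        · congr 2; omega
      rw [e0, if_neg (by omega), if_neg (by omega), if_neg (by omega),
        show j + d + 1 - j = d + 1 by omega, show j + d + 1 + 1 - j = d + 1 + 1 by omega]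
      push_cast
      simp only [pow_succ]
      linear_combination (1 / r * N ^ j * β ^ d) * hβ1
    · rw [if_pos le_rfl, if_pos rfl, if_pos (by omega), if_neg (by omega),
        show j + 1 - j = 1 by omega, Nat.sub_self]
      push_cast
      have h1 : 1 / r * r = 1 := by field_simp
      linear_combination (1 / r * N ^ j) * hβ2 + (N : ℂ) ^ j * h1
    · obtain ⟨d, rfl⟩ := Nat.exists_eq_add_of_lt h
      rw [if_pos (by omega), if_neg (by omega), if_pos (by omega), if_pos (by omega),
        show k + d + 1 - k = d + 1 by omega, show k + d + 1 + 1 - k = d + 1 + 1 by omega,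
        show k + d + 1 - (k + 1) = d by omega]
      push_cast
      simp only [pow_succ]
      linear_combination (1 / r * N ^ k * β ^ d) * hβ1
  have hψN : ∀ j k, ‖ψ j k‖ ≤ (‖1 / r‖ • fun j k => N ^ j + N ^ k : ℕ → ℕ → ℝ) j k := by
    intro j k
    have hpow : ∀ a b : ℕ, ‖(N : ℂ) ^ a * β ^ b‖ ≤ N ^ (a + b) := fun a b => by
      rw [norm_mul, norm_pow, norm_pow, Complex.norm_real, Real.norm_of_nonneg (by linarith),
        pow_add]
      gcongr
    simp only [hψ, Pi.smul_apply, smul_eq_mul, norm_mul]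
    gcongr
    have hj : 0 ≤ N ^ j := by positivity
    have hk : 0 ≤ N ^ k := by positivity
    split_ifs with h
    · have := hpow k (j - k)
      rw [Nat.add_sub_cancel' h] at this
      linarith
    · have := hpow j (k - j)
      rw [Nat.add_sub_cancel' (by omega)] at this
      linarith
  have hs : Summable fun k => (diagCoeff N k : ℂ) * v ^ k :=
    summable_of_le_pow (diagCoeff_nonneg hN1)
      (fun k => (diagCoeff_le hN1 k).trans (maxCoeff_le hN1 k)) (by linarith) hv
  have hval : ψ 0 0 = 1 / r := by simp [hψ]
  rw [← hval]
  have key := eq_of_hasSum_of_recursion (x := fun m => (sigma ℂ ^ m) ψ 0 0)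
    (β := fun k => (diagCoeff N k : ℂ)) (v := v) (C := 2 * ‖1 / r‖) (R := N + 1)
    (s := ∑' k, (diagCoeff N k : ℂ) * v ^ k) ?_ ?_ hv (by linarith) ?_
  · simp only [pow_zero, Module.End.one_apply] at key
    rw [key]
    exact hs.hasSum
  · intro m
    conv_lhs => rw [hsig]
    simp only [map_add, map_smul, Pi.add_apply, Pi.smul_apply, smul_eq_mul, sigma_ofReal]
    rw [← Module.End.mul_apply, ← pow_succ, add_comm]
    rfl
  · intro m
    refine (norm_sigma_pow_le hψN m 0 0).trans (le_of_eq ?_)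
    rw [map_smul, sigma_pow_eigen (sigma_pow_add_pow N)]
    simp only [Pi.smul_apply, smul_eq_mul, pow_zero]
    ring
  · simpa only [mul_comm] using hs.hasSum

omit hr hre in
theorem one_sub_mul_ne_zero : 1 - (N + 1) * v ≠ 0 := fun h => by
  have h1 : v * (N + 1) = 1 := by linear_combination -h
  have h2 := congrArg norm h1
  rw [norm_mul, show (N + 1 : ℂ) = ((N + 1 : ℝ) : ℂ) by push_cast; rfl, Complex.norm_real,
    Real.norm_of_nonneg (by linarith), norm_one] at h2
  linarith

/-- The recursion `maxCoeff_succ` becomes a linear equation for the generating function, with the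
diagonal sum 1/r as its inhomogeneous term. -/
theorem hasSum_maxCoeff_succ : HasSum (fun k => (maxCoeff N (k + 1) : ℂ) * v ^ k)
    ((N + 1 + (N - 1) / r) / (1 - (N + 1) * v)) := by
  have hN1 : 1 ≤ N := by linarith
  have hd := hasSum_diagCoeff hN hv hr hre
  have hne := one_sub_mul_ne_zero hN hv
  have hs : Summable fun k => (maxCoeff N k : ℂ) * v ^ k :=
    summable_of_le_pow (maxCoeff_nonneg hN1) (maxCoeff_le hN1) (by linarith) hv
  obtain ⟨b, hb⟩ := hs
  have h1 : HasSum (fun k => (maxCoeff N (k + 1) : ℂ) * v ^ k)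
      ((N + 1) * b + (N - 1) * (1 / r)) := by
    refine ((hb.mul_left (N + 1 : ℂ)).add (hd.mul_left (N - 1 : ℂ))).congr_fun fun k => ?_
    rw [maxCoeff_succ]
    push_cast
    ring
  have h2 : b = 1 + v * ((N + 1) * b + (N - 1) * (1 / r)) := by
    have h3 := (hasSum_nat_add_iff' 1).2 hb
    have h4 := (h1.mul_left v).congr_fun (g := fun k => (maxCoeff N (k + 1) : ℂ) * v ^ (k + 1))
      fun k => by ring
    have h5 := h3.unique h4
    simp [maxCoeff_zero] at h5
    linear_combination h5
  convert h1 using 1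
  rw [div_eq_iff hne]
  linear_combination (-(N + 1) : ℂ) * h2

end


/-! ### The principal square root -/

theorem sqrt_sq' (a : ℂ) : a.sqrt ^ 2 = a := by
  simp [Complex.sqrt]

theorem sqrt_re (a : ℂ) : a.sqrt.re = √((‖a‖ + a.re) / 2) := by
  rw [Complex.sqrt, Complex.cpow_inv_two_re]

theorem sqrt_eq_of_sq_eq {a w : ℂ} (h : w ^ 2 = a) (hw : 0 < w.re) : a.sqrt = w := by
  rcases sq_eq_sq_iff_eq_or_eq_neg.1 ((sqrt_sq' a).trans h.symm) with h1 | h1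
  · exact h1
  · have h2 := sqrt_re a
    rw [h1, Complex.neg_re] at h2
    have := Real.sqrt_nonneg ((‖a‖ + a.re) / 2)
    linarith

theorem sqrt_re_pos {a : ℂ} (ha : 0 < a.re) : 0 < a.sqrt.re := by
  rw [sqrt_re]
  have := norm_nonneg a
  positivity

theorem hasDerivAt_sqrt' {a : ℂ} (ha : 0 < a.re) :
    HasDerivAt Complex.sqrt (1 / (2 * a.sqrt)) a := by
  convert Complex.hasDerivAt_sqrt (.inl ha : a ∈ Complex.slitPlane) using 1
  rw [show (-1 / 2 : ℂ) = -2⁻¹ by norm_num, Complex.cpow_neg, ← Complex.sqrt]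
  field_simp

section dyck

variable {N : ℝ} {v : ℂ} (hN : 2 ≤ N) (hv : ‖v‖ * (N + 1) < 1)
include hN hv

/-- From 4N ≤ (N+1)² one gets |4Nv²| < 1. -/
theorem re_discriminant_pos : 0 < (1 - 4 * N * v ^ 2 : ℂ).re := by
  have h1 : ‖(4 * N * v ^ 2 : ℂ)‖ < 1 := by
    rw [norm_mul, norm_mul, norm_pow, Complex.norm_real, Real.norm_of_nonneg (by linarith),
      show ‖(4 : ℂ)‖ = 4 by simp]
    have h2 : (‖v‖ * (N + 1)) ^ 2 < 1 := by
      have : 0 ≤ ‖v‖ * (N + 1) := by positivity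
      nlinarith
    nlinarith [sq_nonneg (N - 1), mul_nonneg (sq_nonneg ‖v‖) (sq_nonneg (N - 1))]
  have h3 := Complex.re_le_norm (4 * N * v ^ 2 : ℂ)
  rw [Complex.sub_re, Complex.one_re]
  linarith

/-- The square root that occurs in the zeta function of the Dyck shift. -/
noncomputable abbrev discSqrt (N : ℝ) (v : ℂ) : ℂ := Complex.sqrt (1 - 4 * N * v ^ 2)

theorem discSqrt_re_pos : 0 < (discSqrt N v).re := sqrt_re_pos (re_discriminant_pos hN hv)

theorem discSqrt_ne_zero : discSqrt N v ≠ 0 := fun h => by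
  have := discSqrt_re_pos hN hv
  simp [h] at this

theorem one_add_discSqrt_ne_zero : 1 + discSqrt N v ≠ 0 := fun h => by
  have h1 := discSqrt_re_pos hN hv
  have h2 := congrArg Complex.re h
  simp only [Complex.add_re, Complex.one_re, Complex.zero_re] at h2
  linarith

/-- Squaring the equation would give v(1 - (N+1)v) = 0, hence v = 0 and a square root equal to -1,
against its positive real part. -/
theorem denominator_ne_zero : 1 - 2 * N * v + discSqrt N v ≠ 0 := fun h => by
  have h1 : discSqrt N v ^ 2 = 1 - 4 * N * v ^ 2 := sqrt_sq' _
  have h2 : discSqrt N v = 2 * N * v - 1 := by linear_combination h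
  rw [h2] at h1
  have hN0 : (N : ℂ) ≠ 0 := by
    rw [Ne, Complex.ofReal_eq_zero]
    linarith
  have h3 : (4 * N : ℂ) * (v * (1 - (N + 1) * v)) = 0 := by linear_combination -h1
  have h4 := one_sub_mul_ne_zero hN hv
  have h5 : v = 0 := by simpa [hN0, h4] using h3
  have h6 := discSqrt_re_pos hN hv
  rw [h2, h5] at h6
  simp at h6
  linarith

/-- The zeta function of the Dyck shift. -/
noncomputable def dyckZeta (N : ℝ) (v : ℂ) : ℂ :=
  2 * (1 + discSqrt N v) / (1 - 2 * N * v + discSqrt N v) ^ 2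

/-- The logarithmic derivative is the sum from `hasSum_maxCoeff_succ`, which is what identifies the
closed form. -/
theorem hasDerivAt_dyckZeta : HasDerivAt (dyckZeta N)
    (dyckZeta N v * ((N + 1 + (N - 1) / discSqrt N v) / (1 - (N + 1) * v))) v := by
  have hr0 := discSqrt_ne_zero hN hv
  have hr1 := one_add_discSqrt_ne_zero hN hv
  have hr2 := denominator_ne_zero hN hv
  have hv1 := one_sub_mul_ne_zero hN hv
  have hsq : discSqrt N v ^ 2 = 1 - 4 * N * v ^ 2 := sqrt_sq' _
  have h1 : HasDerivAt (fun v : ℂ => 1 - 4 * N * v ^ 2) (-(8 * N * v)) v := by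
    have := ((hasDerivAt_pow 2 v).const_mul (4 * N : ℂ)).const_sub 1
    refine this.congr_deriv ?_
    simp
    ring
  have h2 : HasDerivAt (discSqrt N) (-(4 * N * v) / discSqrt N v) v := by
    refine ((hasDerivAt_sqrt' (re_discriminant_pos hN hv)).comp v h1).congr_deriv ?_
    change 1 / (2 * discSqrt N v) * _ = _
    field_simp
    ring
  have h3 : HasDerivAt (fun v : ℂ => 1 - 2 * N * v + discSqrt N v)
      (-(2 * N) + -(4 * N * v) / discSqrt N v) v := by
    have := (((hasDerivAt_id v).const_mul (2 * N : ℂ)).const_sub 1).add h2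
    refine this.congr_deriv ?_
    simp
  have h4 := ((h2.const_add 1).const_mul 2).div (h3.pow 2) (pow_ne_zero 2 hr2)
  refine h4.congr_deriv ?_
  -- The claimed equality with common factors and denominators cleared; it holds modulo r² = 1 -
  -- 4Nv².
  have key : (1 - (N + 1) * v) * (4 * N * (1 + discSqrt N v) * (discSqrt N v + 2 * v) -
      4 * N * v * (1 - 2 * N * v + discSqrt N v)) =
      (1 + discSqrt N v) * ((N + 1) * discSqrt N v + N - 1) *
        (1 - 2 * N * v + discSqrt N v) := by
    linear_combination (-(N + 1) * discSqrt N v + 4 * N * (1 - (N + 1) * v) - (N - 1) -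
      (N + 1) * (2 - 2 * N * v)) * hsq
  rw [dyckZeta]
  simp only [Nat.cast_ofNat, Nat.add_one_sub_one, pow_one, Pi.pow_apply]
  clear h1 h2 h3 h4
  generalize discSqrt N v = r at *
  generalize hD : 1 - 2 * N * v + r = D at *
  generalize 1 - (N + 1) * v = w at *
  have e1 : (2 * (-(4 * N * v) / r) * D ^ 2 -
      2 * (1 + r) * (2 * D * (-(2 * N) + -(4 * N * v) / r))) / (D ^ 2) ^ 2 =
      2 * (4 * N * (1 + r) * (r + 2 * v) - 4 * N * v * D) / (r * D ^ 3) := by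
    field_simp
    ring
  have e2 : 2 * (1 + r) / D ^ 2 * ((N + 1 + (N - 1) / r) / w) =
      2 * ((1 + r) * ((N + 1) * r + N - 1)) / (r * D ^ 2 * w) := by
    field_simp
    ring
  rw [e1, e2, div_eq_div_iff (mul_ne_zero hr0 (pow_ne_zero 3 hr2))
    (mul_ne_zero (mul_ne_zero hr0 (pow_ne_zero 2 hr2)) hv1)]
  linear_combination (2 * r * D ^ 2) * key

end dyck


/-! ### The zeta function on its disk -/

section root

variable {N l : ℝ} (hN : 2 ≤ N) (hl : l ^ 2 - (N + 2) * l + N = 0) (hl2 : N + 2 ≤ 2 * l)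
include hN hl hl2

theorem root_gt : 10 / 3 < l := by
  by_contra h
  -- For p(x) = x² - (N+2)x + N the product is p(10/3) - p(l) = p(10/3), which is negative when N ≥
  -- 2.
  nlinarith [mul_nonneg (by linarith : 0 ≤ 10 / 3 - l) (by linarith : 0 ≤ 10 / 3 + l - N - 2)]

theorem root_gt_add_one : N + 1 < l := by
  by_contra h
  -- The same argument, with p(N+1) = -1.
  nlinarith [mul_nonneg (by linarith : 0 ≤ N + 1 - l) (by linarith : 0 ≤ N + 1 + l - N - 2)]

theorem conj_root_nonneg : 0 ≤ N + 2 - l := by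
  have h : l * (N + 2 - l) = N := by linarith
  have h1 := root_gt hN hl hl2
  by_contra hneg
  nlinarith

theorem traceCoeff_le' (k n : ℕ) : traceCoeff N k n ≤ 4 * (N + 1) ^ k * l ^ n := by
  have h := traceCoeff_le (by linarith : 1 ≤ N) hl k n
  have h1 : (N + 2 - l) ^ n ≤ l ^ n :=
    pow_le_pow_left₀ (conj_root_nonneg hN hl hl2) (by linarith) n
  have h2 : 0 ≤ (N + 1) ^ k := by positivity
  nlinarith [mul_le_mul_of_nonneg_left h1 h2]

end root

/-- The denominator of the zeta function of the even system. -/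
noncomputable abbrev evenDen (z : ℂ) : ℂ := 1 - z - z ^ 2

/-- The generating function of the excursions from the vertex `v_odd`. -/
noncomputable abbrev bracketVar (z : ℂ) : ℂ := z * (1 - z) / evenDen z

section disk

variable {N l : ℝ} {z : ℂ} (hN : 2 ≤ N) (hl : l ^ 2 - (N + 2) * l + N = 0)
  (hl2 : N + 2 ≤ 2 * l) (hz : ‖z‖ * l < 1)
include hN hl hl2 hz

theorem norm_lt_of_disk : ‖z‖ < 3 / 10 := by
  have := root_gt hN hl hl2
  nlinarith [norm_nonneg z]

/-- With x = |z|, the bounds |1-z| ≥ 1-x and |1-z-z²| ≥ |1-z| - x² reduce the claim to 1 - (N+2)x +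
Nx² > 0. This is (1 - lx)(1 - (N+2-l)x), a product of positive factors. -/
theorem norm_mul_lt_norm_evenDen : ‖z * (1 - z)‖ * (N + 1) < ‖evenDen z‖ := by
  have hx := norm_nonneg z
  have h1 : 1 - ‖z‖ ≤ ‖1 - z‖ := by simpa using norm_sub_norm_le (1 : ℂ) z
  have h2 : ‖1 - z‖ - ‖z‖ ^ 2 ≤ ‖evenDen z‖ := by
    rw [← norm_pow]
    exact norm_sub_norm_le (1 - z) (z ^ 2)
  have h3 : ‖z‖ * (N + 1) < 1 := by nlinarith [root_gt_add_one hN hl hl2]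
  have h4 : ‖z‖ * (N + 2 - l) < 1 := by nlinarith
  have h5 := mul_pos (sub_pos.2 hz) (sub_pos.2 h4)
  rw [norm_mul]
  nlinarith [mul_le_mul_of_nonneg_right h1 (sub_pos.2 h3).le]

theorem evenDen_ne_zero : evenDen z ≠ 0 := fun h => by
  have h1 := norm_mul_lt_norm_evenDen hN hl hl2 hz
  rw [h, norm_zero] at h1
  have : 0 ≤ ‖z * (1 - z)‖ * (N + 1) := by positivity
  linarith

theorem norm_bracketVar : ‖bracketVar z‖ * (N + 1) < 1 := by
  have h1 := norm_mul_lt_norm_evenDen hN hl hl2 hz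
  have h2 : 0 < ‖evenDen z‖ := norm_pos_iff.2 (evenDen_ne_zero hN hl hl2 hz)
  rw [norm_div, div_mul_eq_mul_div, div_lt_one h2]
  exact h1

theorem summable_traceCoeff (k m : ℕ) :
    Summable fun n => (traceCoeff N k (n + m) : ℂ) * z ^ n :=
  summable_of_le_pow (C := 4 * (N + 1) ^ k * l ^ m) (fun n => traceCoeff_nonneg (by linarith) _ _)
    (fun n => (traceCoeff_le' hN hl hl2 k (n + m)).trans (le_of_eq (by ring)))
    (by linarith) hz

theorem tsum_traceCoeff (k m : ℕ) :
    ∑' n, (traceCoeff N k (n + m) : ℂ) * z ^ n =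
      traceCoeff N k m + z * ∑' n, (traceCoeff N k (n + (m + 1)) : ℂ) * z ^ n := by
  rw [(summable_traceCoeff hN hl hl2 hz k m).tsum_eq_zero_add, ← tsum_mul_left]
  simp only [zero_add, pow_zero, mul_one]
  congr 1
  refine tsum_congr fun n => ?_
  rw [add_right_comm, add_assoc]
  ring

/-- Cayley-Hamilton summed against powers of z. Solving for the series at level k divides by 1-z-z²
and leaves v times the series at level k + 1. -/
theorem tsum_traceCoeff_recursion (k : ℕ) :
    ∑' n, (traceCoeff N k (n + 1) : ℂ) * z ^ n =
      bracketVar z * ∑' n, (traceCoeff N (k + 1) (n + 1) : ℂ) * z ^ n +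
      ((1 + 2 * z) * maxCoeff N k + (1 - 2 * z) * maxCoeff N (k + 1)) / evenDen z := by
  have hne := evenDen_ne_zero hN hl hl2 hz
  have hs := fun k m => (summable_traceCoeff hN hl hl2 hz k m).hasSum
  have h3 : ∑' n, (traceCoeff N k (n + 3) : ℂ) * z ^ n =
      ∑' n, (traceCoeff N k (n + 2) : ℂ) * z ^ n +
      ∑' n, (traceCoeff N (k + 1) (n + 2) : ℂ) * z ^ n -
      ∑' n, (traceCoeff N (k + 1) (n + 1) : ℂ) * z ^ n +
      ∑' n, (traceCoeff N k (n + 1) : ℂ) * z ^ n := by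
    refine HasSum.tsum_eq (((((hs k 2).add (hs (k + 1) 2)).sub (hs (k + 1) 1)).add
      (hs k 1)).congr_fun fun n => ?_)
    rw [traceCoeff_add_two N k (n + 1)]
    push_cast
    ring
  have h1 := tsum_traceCoeff hN hl hl2 hz k 1
  have h2 := tsum_traceCoeff hN hl hl2 hz k 2
  have h1' := tsum_traceCoeff hN hl hl2 hz (k + 1) 1
  have hone : ∀ k, (traceCoeff N k 1 : ℂ) = maxCoeff N k + maxCoeff N (k + 1) := fun k => by
    rw [traceCoeff_one]; push_cast; rfl
  have htwo : (traceCoeff N k 2 : ℂ) = 3 * maxCoeff N k + maxCoeff N (k + 2) := by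
    have := traceCoeff_add_two N k 0
    rw [traceCoeff_zero, traceCoeff_zero, zero_add, zero_add, traceCoeff_one,
      traceCoeff_one] at this
    rw [this]
    push_cast
    ring
  rw [hone] at h1 h1'
  rw [htwo] at h2
  simp only [Nat.reduceAdd] at h1 h2 h1'
  rw [bracketVar, div_mul_eq_mul_div, ← add_div, eq_div_iff hne, evenDen]
  linear_combination (1 - z) * h1 + z * h2 + z ^ 2 * h3 - z * h1'

theorem tsum_traceCoeff_eq : ∑' n, (traceCoeff N 0 (n + 1) : ℂ) * z ^ n =
    ((1 + 2 * z) * (1 + bracketVar z * ((N + 1 + (N - 1) / discSqrt N (bracketVar z)) /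
      (1 - (N + 1) * bracketVar z))) + (1 - 2 * z) *
      ((N + 1 + (N - 1) / discSqrt N (bracketVar z)) / (1 - (N + 1) * bracketVar z))) /
      evenDen z := by
  have hv := norm_bracketVar hN hl hl2 hz
  have hb1 := hasSum_maxCoeff_succ hN hv (sqrt_sq' _) (discSqrt_re_pos hN hv)
  set v := bracketVar z
  set b1 := (N + 1 + (N - 1) / discSqrt N v) / (1 - (N + 1) * v)
  have hb : HasSum (fun k => (maxCoeff N k : ℂ) * v ^ k) (1 + v * b1) := by
    have h := (hb1.mul_left v).congr_fun (g := fun k => (maxCoeff N (k + 1) : ℂ) * v ^ (k + 1))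
      fun k => by ring
    exact (hasSum_nat_add_iff' 1).1 (by simpa [maxCoeff_zero] using h)
  -- The recursion is iterated in the power k of σ; the series at level k grows at most like
  -- (N+1)^k, and |v|(N+1) < 1.
  refine eq_of_hasSum_of_recursion
    (x := fun k => ∑' n, (traceCoeff N k (n + 1) : ℂ) * z ^ n)
    (β := fun k => ((1 + 2 * z) * maxCoeff N k + (1 - 2 * z) * maxCoeff N (k + 1)) / evenDen z)
    (v := v) (C := 4 * l * (1 - l * ‖z‖)⁻¹) (R := N + 1)
    (tsum_traceCoeff_recursion hN hl hl2 hz) (fun k => ?_) hv (by linarith) ?_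
  · have hl0 : 0 ≤ l := by linarith
    have hg := (hasSum_geometric_of_lt_one (by positivity : 0 ≤ l * ‖z‖)
      (by linarith)).mul_left (4 * (N + 1) ^ k * l)
    refine (tsum_of_norm_bounded hg fun n => ?_).trans (le_of_eq (by ring))
    rw [norm_mul, norm_pow, Complex.norm_real,
      Real.norm_of_nonneg (traceCoeff_nonneg (by linarith) _ _), mul_pow]
    calc traceCoeff N k (n + 1) * ‖z‖ ^ n ≤ 4 * (N + 1) ^ k * l ^ (n + 1) * ‖z‖ ^ n := by
          gcongr
          exact traceCoeff_le' hN hl hl2 k (n + 1)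
      _ = _ := by ring
  · refine (((hb.mul_left (1 + 2 * z)).add (hb1.mul_left (1 - 2 * z))).div_const
      (evenDen z)).congr_fun fun k => ?_
    ring

/-- The zeta function of the shift. -/
noncomputable def closedForm (N : ℝ) (z : ℂ) : ℂ :=
  (1 + z) / evenDen z * dyckZeta N (bracketVar z)

theorem one_add_ne_zero_of_disk : 1 + z ≠ 0 := fun h => by
  have h1 := norm_lt_of_disk hN hl hl2 hz
  have : z = -1 := by linear_combination h
  rw [this] at h1
  norm_num at h1

theorem hasDerivAt_closedForm : HasDerivAt (closedForm N)
    (closedForm N z * (∑' n, (traceCoeff N 0 (n + 1) : ℂ) * z ^ n + 1 / (1 + z))) z := by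
  have hne := evenDen_ne_zero hN hl hl2 hz
  have hne1 := one_add_ne_zero_of_disk hN hl hl2 hz
  have hv := norm_bracketVar hN hl hl2 hz
  have h1 : HasDerivAt evenDen (-1 - 2 * z) z := by
    refine (((hasDerivAt_id z).const_sub 1).sub (hasDerivAt_pow 2 z)).congr_deriv ?_
    simp
  have h2 : HasDerivAt bracketVar ((1 - 2 * z + (1 + 2 * z) * bracketVar z) / evenDen z) z := by
    refine (((hasDerivAt_id z).mul ((hasDerivAt_id z).const_sub 1)).div h1 hne).congr_deriv ?_
    simp only [id, Pi.mul_apply, bracketVar]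
    field_simp
    ring
  have h3 := ((((hasDerivAt_id z).const_add 1).div h1 hne).mul
    ((hasDerivAt_dyckZeta hN hv).comp z h2))
  refine h3.congr_deriv ?_
  rw [tsum_traceCoeff_eq hN hl hl2 hz, closedForm]
  simp only [Function.comp, id, Pi.div_apply]
  generalize (N + 1 + (N - 1) / discSqrt N (bracketVar z)) / (1 - (N + 1) * bracketVar z) = b
  generalize dyckZeta N (bracketVar z) = f
  generalize bracketVar z = v
  generalize evenDen z = D at *
  field_simp
  ring

end disk


/-! ### Identification of the zeta series with the closed form -/

section zeta

variable {Γ : Type*} [Fintype Γ] {l : ℝ} {z : ℂ}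

theorem ncard_periodicPoints_succ (n : ℕ) :
    ((periodicPoints (evenOddShift Γ).carrier (n + 1)).ncard : ℂ) =
      traceCoeff (Fintype.card Γ) 0 (n + 1) + (-1) ^ n := by
  have h := ncard_periodicPoints_eq_traceCoeff (Γ := Γ) n.succ_pos
  rw [Nat.succ_eq_add_one, add_assoc n 1 1, pow_add] at h
  have h' := congrArg (fun x : ℝ => (x : ℂ)) h
  push_cast at h'
  rw [h']
  norm_num

theorem hasDerivAt_zetaTerm {A : Type*} (Y : Set (ℤ → A)) (n : ℕ) (z : ℂ) :
    HasDerivAt (fun z => zetaTerm Y z n) ((periodicPoints Y (n + 1)).ncard * z ^ n) z := by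
  refine ((hasDerivAt_pow (n + 1) z).const_mul
    (1 / ((n + 1 : ℕ) : ℂ) * ((periodicPoints Y (n + 1)).ncard : ℂ))).congr_deriv ?_
  have : ((n + 1 : ℕ) : ℂ) ≠ 0 := Nat.cast_ne_zero.2 n.succ_ne_zero
  rw [Nat.add_sub_cancel]
  field_simp

theorem zetaTerm_zero {A : Type*} (Y : Set (ℤ → A)) (n : ℕ) : zetaTerm Y 0 n = 0 := by
  simp [zetaTerm]

variable (hN : 2 ≤ (Fintype.card Γ : ℝ))
  (hl : l ^ 2 - (Fintype.card Γ + 2) * l + Fintype.card Γ = 0)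
  (hl2 : (Fintype.card Γ : ℝ) + 2 ≤ 2 * l)
include hN hl hl2

theorem norm_ncard_mul_pow_le {R : ℝ} (hz : ‖z‖ ≤ R) (n : ℕ) :
    ‖((periodicPoints (evenOddShift Γ).carrier (n + 1)).ncard : ℂ) * z ^ n‖ ≤
      (4 * l + 1) * (R * l) ^ n := by
  have hl1 : 1 ≤ l := by linarith
  have hpos := traceCoeff_nonneg (by linarith : (1 : ℝ) ≤ Fintype.card Γ) 0 (n + 1)
  have hle := traceCoeff_le' hN hl hl2 0 (n + 1)
  have h1 : ‖((periodicPoints (evenOddShift Γ).carrier (n + 1)).ncard : ℂ)‖ ≤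
      (4 * l + 1) * l ^ n := by
    rw [ncard_periodicPoints_succ]
    refine (norm_add_le _ _).trans ?_
    rw [Complex.norm_real, Real.norm_of_nonneg hpos, norm_pow, norm_neg, norm_one, one_pow]
    have : 1 ≤ l ^ n := one_le_pow₀ hl1
    rw [pow_succ] at hle
    linarith
  rw [norm_mul, norm_pow]
  calc _ ≤ (4 * l + 1) * l ^ n * R ^ n := by gcongr
    _ = _ := by ring

theorem hasDerivAt_tsum_zetaTerm (hz : ‖z‖ * l < 1) :
    Summable (zetaTerm (evenOddShift Γ).carrier z) ∧
      HasDerivAt (fun z => ∑' n, zetaTerm (evenOddShift Γ).carrier z n)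
        (∑' n, (traceCoeff (Fintype.card Γ) 0 (n + 1) : ℂ) * z ^ n + 1 / (1 + z)) z := by
  have hl0 : 0 < l := by linarith
  -- A radius strictly between |z| and 1/l gives one geometric majorant on a whole ball, as termwise
  -- differentiation requires.
  obtain ⟨R, hR, hR'⟩ := exists_between ((lt_div_iff₀ hl0).2 hz)
  rw [lt_div_iff₀ hl0] at hR'
  have hR0 : 0 < R := (norm_nonneg z).trans_lt hR
  have hu : Summable fun n => (4 * l + 1) * (R * l) ^ n :=
    (summable_geometric_of_lt_one (by positivity) hR').mul_left _
  have hb : ∀ (n : ℕ), ∀ y ∈ Metric.ball (0 : ℂ) R,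
      ‖((periodicPoints (evenOddShift Γ).carrier (n + 1)).ncard : ℂ) * y ^ n‖ ≤
      (4 * l + 1) * (R * l) ^ n := fun n y hy =>
    norm_ncard_mul_pow_le hN hl hl2 (mem_ball_zero_iff.1 hy).le n
  have h0 : Summable fun n => zetaTerm (evenOddShift Γ).carrier 0 n := by
    simp only [zetaTerm_zero]
    exact summable_zero
  have hz' : z ∈ Metric.ball (0 : ℂ) R := mem_ball_zero_iff.2 hR
  have hd := hasDerivAt_tsum_of_isPreconnected hu Metric.isOpen_ball
    (convex_ball (0 : ℂ) R).isPreconnected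
    (fun n y _ => hasDerivAt_zetaTerm (evenOddShift Γ).carrier n y) hb
    (Metric.mem_ball_self hR0) h0 hz'
  constructor
  · refine Summable.of_norm_bounded (hu.mul_right ‖z‖) fun n => ?_
    have h1 : zetaTerm (evenOddShift Γ).carrier z n = 1 / ((n + 1 : ℕ) : ℂ) *
        (((periodicPoints (evenOddShift Γ).carrier (n + 1)).ncard : ℂ) * z ^ n * z) := by
      rw [zetaTerm]; ring
    have h2 : ‖1 / ((n + 1 : ℕ) : ℂ)‖ ≤ 1 := by
      rw [norm_div, norm_one, Complex.norm_natCast, div_le_one (by positivity)]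
      push_cast
      linarith [n.cast_nonneg (α := ℝ)]
    rw [h1, norm_mul, norm_mul _ z]
    calc _ ≤ 1 * ((4 * l + 1) * (R * l) ^ n * ‖z‖) := by gcongr; exact hb n z hz'
      _ = _ := one_mul _
  · refine hd.congr_deriv ?_
    have hz1 : ‖-z‖ < 1 := by
      rw [norm_neg]
      nlinarith [norm_nonneg z]
    have hgeo := hasSum_geometric_of_norm_lt_one hz1
    rw [sub_neg_eq_add, ← one_div] at hgeo
    refine HasSum.tsum_eq (((summable_traceCoeff hN hl hl2 hz 0 1).hasSum.add
      hgeo).congr_fun fun n => ?_)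
    rw [ncard_periodicPoints_succ, neg_pow z]
    ring

/-- Both sides have the same logarithmic derivative, so their quotient is constant on the disk; it
equals 1 at 0. -/
theorem zeta_eq_closedForm (hz : ‖z‖ * l < 1) :
    zeta (evenOddShift Γ).carrier z = closedForm (Fintype.card Γ) z := by
  have hl0 : 0 < l := by linarith
  have hmem : ∀ y ∈ Metric.ball (0 : ℂ) (1 / l), ‖y‖ * l < 1 := fun y hy => by
    rwa [mem_ball_zero_iff, lt_div_iff₀ hl0] at hy
  have hd : ∀ y ∈ Metric.ball (0 : ℂ) (1 / l), HasDerivAt (fun y =>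
      Complex.exp (-∑' n, zetaTerm (evenOddShift Γ).carrier y n) *
        closedForm (Fintype.card Γ) y) 0 y := fun y hy => by
    have h1 := ((hasDerivAt_tsum_zetaTerm hN hl hl2 (hmem y hy)).2.neg.cexp).mul
      (hasDerivAt_closedForm hN hl hl2 (hmem y hy))
    refine h1.congr_deriv ?_
    simp only [Pi.neg_apply]
    ring
  have hc := Metric.isOpen_ball.is_const_of_deriv_eq_zero
    (convex_ball (0 : ℂ) (1 / l)).isPreconnected
    (fun y hy => (hd y hy).differentiableAt.differentiableWithinAt)
    (fun y hy => (hd y hy).deriv) (x := z) (y := 0)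
    (by rwa [mem_ball_zero_iff, lt_div_iff₀ hl0]) (Metric.mem_ball_self (by positivity))
  have h0 : closedForm (Fintype.card Γ) 0 = 1 := by
    simp [closedForm, dyckZeta, discSqrt]
    norm_num
  simp only [zetaTerm_zero, tsum_zero, neg_zero, Complex.exp_zero, h0, mul_one] at hc
  rw [Complex.exp_neg, inv_mul_eq_one₀ (Complex.exp_ne_zero _)] at hc
  exact hc

end zeta

section closedForm

variable {N l : ℝ} {z : ℂ} (hN : 2 ≤ N) (hl : l ^ 2 - (N + 2) * l + N = 0)
  (hl2 : N + 2 ≤ 2 * l) (hz : ‖z‖ * l < 1)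
include hN hl hl2 hz

/-- The right side squares correctly, so only the branch is at stake. Both factors lie in the sector
|im| < re, hence their product has positive real part and is the principal root. -/
theorem sqrt_eq_evenDen_mul : Complex.sqrt ((1 - z - z ^ 2) ^ 2 - 4 * N * z ^ 2 * (1 - z) ^ 2) =
    evenDen z * discSqrt N (bracketVar z) := by
  have hne := evenDen_ne_zero hN hl hl2 hz
  have hv := norm_bracketVar hN hl hl2 hz
  have hsq : discSqrt N (bracketVar z) ^ 2 = 1 - 4 * N * bracketVar z ^ 2 := sqrt_sq' _
  have hre := re_discriminant_pos hN hv
  have hrpos := discSqrt_re_pos hN hv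
  refine sqrt_eq_of_sq_eq ?_ ?_
  · rw [mul_pow, hsq, bracketVar]
    field_simp
  · have hx := norm_lt_of_disk hN hl hl2 hz
    have hx0 := norm_nonneg z
    -- From |z| < 3/10, as 39/100 = 3/10 + 9/100; any bound below 1/2 would put 1-z-z² in the
    -- sector.
    have h1 : ‖z + z ^ 2‖ ≤ 39 / 100 := by
      refine (norm_add_le _ _).trans ?_
      rw [norm_pow]
      nlinarith
    have h2 := (Complex.abs_re_le_norm _).trans h1
    have h3 := (Complex.abs_im_le_norm _).trans h1
    have h4 : evenDen z = 1 - (z + z ^ 2) := by rw [evenDen]; ring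
    rw [abs_le] at h2 h3
    have hre1 : (evenDen z).re = 1 - (z + z ^ 2).re := by rw [h4]; simp
    have him1 : (evenDen z).im = -(z + z ^ 2).im := by rw [h4]; simp
    have h5 : |(evenDen z).im| < (evenDen z).re := by
      rw [hre1, him1, abs_lt]
      constructor <;> linarith
    rw [← hsq, sq, Complex.mul_re] at hre
    have h6 : |(discSqrt N (bracketVar z)).im| < (discSqrt N (bracketVar z)).re :=
      abs_lt_of_sq_lt_sq (by linarith) hrpos.le
    rw [Complex.mul_re, sub_pos]
    calc _ ≤ |(evenDen z).im * (discSqrt N (bracketVar z)).im| := le_abs_self _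
      _ = |(evenDen z).im| * |(discSqrt N (bracketVar z)).im| := abs_mul _ _
      _ < _ := mul_lt_mul'' h5 h6 (abs_nonneg _) (abs_nonneg _)

theorem closedForm_eq : closedForm N z =
    2 * (1 + z) * (1 - z - z ^ 2 +
        Complex.sqrt ((1 - z - z ^ 2) ^ 2 - 4 * N * z ^ 2 * (1 - z) ^ 2)) /
      (1 - (2 * N + 1) * z + (2 * N - 1) * z ^ 2 +
        Complex.sqrt ((1 - z - z ^ 2) ^ 2 - 4 * N * z ^ 2 * (1 - z) ^ 2)) ^ 2 := by
  have hne := evenDen_ne_zero hN hl hl2 hz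
  have hv := norm_bracketVar hN hl hl2 hz
  have hden := denominator_ne_zero hN hv
  rw [sqrt_eq_evenDen_mul hN hl hl2 hz, closedForm, dyckZeta]
  generalize hr : discSqrt N (bracketVar z) = r at *
  have h1 : 1 - (2 * N + 1) * z + (2 * N - 1) * z ^ 2 + evenDen z * r =
      evenDen z * (1 - 2 * N * bracketVar z + r) := by
    have : evenDen z * bracketVar z = z * (1 - z) := by rw [bracketVar]; field_simp
    linear_combination (2 * N : ℂ) * this
  rw [h1]
  generalize 1 - 2 * N * bracketVar z + r = d at *
  change _ = 2 * (1 + z) * (evenDen z + evenDen z * r) / _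
  generalize evenDen z = D at *
  field_simp

end closedForm

/-! ### Entropy -/

section entropy

theorem pathSum_mono (n : ℕ) (u : EvenVertex) {F G : List (EvenOddSymbol Unit) → ℝ}
    (h : ∀ s, F s ≤ G s) : pathSum (fun _ => 1) n u F ≤ pathSum (fun _ => 1) n u G := by
  induction n generalizing u F G with
  | zero => simpa [pathSum] using h []
  | succ n ih =>
    cases u
    · exact add_le_add (ih _ fun s => h _) (ih _ fun s => h _)
    · exact add_le_add (add_le_add (ih _ fun s => h _)
        (Finset.sum_le_sum fun γ _ => ih _ fun s => h _))
        (Finset.sum_le_sum fun γ _ => ih _ fun s => h _)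

theorem pathSum_const_mul (n : ℕ) (u : EvenVertex) (c : ℝ) (F : List (EvenOddSymbol Unit) → ℝ) :
    pathSum (fun _ => 1) n u (fun s => c * F s) = c * pathSum (fun _ => 1) n u F := by
  induction n generalizing u F with
  | zero => simp [pathSum]
  | succ n ih => cases u <;> simp [pathSum, ih] <;> ring

/-- An eigenvector of the matrix `!![1, 1; 1, N + 1]`. -/
def vertexWeight (l : ℝ) : EvenVertex → ℝ
  | .even => 1
  | .odd => l - 1

/-- The number of ways to index the brackets of a word so that it becomes admissible. -/
def labelCount (N : ℝ) (s : List (EvenOddSymbol Unit)) : ℝ :=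
  N ^ ((profile s).1 + (profile s).2.1 + (profile s).2.2)

/-- If the new opening bracket finds a partner, the two extensions give the factor 1 + N. If no
closing bracket is unmatched, they give 2N, but then the count itself is N^(number of opening
brackets). -/
theorem labelCount_neg_add_pos {N : ℝ} (hN : 1 ≤ N) (s : List (EvenOddSymbol Unit)) :
    labelCount N (sNeg () :: s) + labelCount N (sPos () :: s) ≤
      (N + 1) * labelCount N s + (N - 1) * N ^ openCount s := by
  have h := (profile_count s).1
  simp only [labelCount, profile]
  rcases hp : profile s with ⟨_ | p, q, k⟩
  · rw [hp] at h
    simp only at h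
    simp only [← h, pow_add, pow_succ]
    apply le_of_eq
    ring
  · have h0 : 0 ≤ (N - 1) * N ^ openCount s := mul_nonneg (by linarith) (by positivity)
    refine le_trans (le_of_eq ?_) (le_add_of_nonneg_right h0)
    simp only [pow_add, pow_succ]
    ring

variable {N l : ℝ} (hN : 2 ≤ N) (hl : l ^ 2 - (N + 2) * l + N = 0) (hl2 : N + 2 ≤ 2 * l)
include hN hl hl2

/-- The vector (1, l-1) is an eigenvector for l and dominates the initial vector (1, 1). -/
theorem pathSum_openCount_le (n : ℕ) (u : EvenVertex) :
    pathSum (fun _ => 1) n u (fun s : List (EvenOddSymbol Unit) => N ^ openCount s) ≤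
      l ^ n * vertexWeight l u := by
  induction n generalizing u with
  | zero => cases u <;> simp [pathSum, openCount, vertexWeight] ; linarith
  | succ n ih =>
    have he := ih .even
    have ho := ih .odd
    simp only [vertexWeight] at he ho
    cases u
    · simp only [pathSum, openCount, vertexWeight]
      rw [pow_succ]
      linarith
    · simp only [pathSum, openCount, vertexWeight, Finset.univ_unique, Finset.sum_singleton]
      simp only [pow_succ, mul_comm _ N, pathSum_const_mul]
      have h1 := mul_le_mul_of_nonneg_left ho (by linarith : 0 ≤ N + 1)
      have h2 : l ^ n * 1 + (N + 1) * (l ^ n * (l - 1)) = l ^ n * l * (l - 1) := by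
        linear_combination (-l ^ n) * hl
      linarith

/-- The recursion is that of the eigenvector plus an excess term which also grows like l^n; this
resonance costs only a linear factor. -/
theorem pathSum_labelCount_le (n : ℕ) (u : EvenVertex) :
    pathSum (fun _ => 1) n u (labelCount N) ≤ (1 + n * N) * (l ^ n * vertexWeight l u) := by
  induction n generalizing u with
  | zero => cases u <;> simp [pathSum, labelCount, profile, vertexWeight] ; linarith
  | succ n ih =>
    have he := ih .even
    have ho := ih .odd
    have hY := pathSum_openCount_le hN hl hl2 n .odd
    simp only [vertexWeight] at he ho hY
    have hln : 0 ≤ l ^ n := pow_nonneg (by linarith) n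
    have hbase : ∀ i, (fun s => labelCount N (.base i :: s)) = labelCount N := fun i => rfl
    cases u
    · simp only [pathSum, vertexWeight, hbase]
      push_cast
      rw [pow_succ]
      have : 0 ≤ N * (l ^ n * l) := by
        have : 0 ≤ l := by linarith
        positivity
      nlinarith
    · simp only [pathSum, vertexWeight, Finset.univ_unique, Finset.sum_singleton, hbase]
      have h1 := pathSum_mono n .odd (labelCount_neg_add_pos (by linarith : 1 ≤ N))
      rw [pathSum_add, pathSum_add, pathSum_const_mul, pathSum_const_mul] at h1
      have h2 := mul_le_mul_of_nonneg_left ho (by linarith : 0 ≤ N + 1)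
      have h3 := mul_le_mul_of_nonneg_left hY (by linarith : 0 ≤ N - 1)
      have h4 : (1 + n * N) * (l ^ n * 1) + (N + 1) * ((1 + n * N) * (l ^ n * (l - 1))) =
          (1 + n * N) * (l ^ (n + 1) * (l - 1)) := by
        rw [pow_succ]
        linear_combination (-(1 + n * N) * l ^ n) * hl
      have h5 : (N - 1) * (l ^ n * (l - 1)) ≤ N * (l ^ (n + 1) * (l - 1)) := by
        rw [pow_succ]
        have h6 : 0 ≤ l ^ n * (l - 1) := mul_nonneg hln (by linarith)
        nlinarith [mul_nonneg h6 (by nlinarith : 0 ≤ N * l - (N - 1))]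
      push_cast
      change _ + pathSum _ n _ (fun s => labelCount N (sNeg () :: s)) +
        pathSum _ n _ (fun s => labelCount N (sPos () :: s)) ≤ _
      linarith

end entropy

/-! ### Bounds for the number of words, and the entropy -/

section language

variable {Γ : Type*} [Fintype Γ] {l : ℝ}

omit [Fintype Γ] in
theorem languageOfLength_subset (n : ℕ) : languageOfLength (evenOddShift Γ).carrier n ⊆
    {w | w.length = n ∧ (∃ v ∈ Set.univ, run .even w = some v) ∧ MotzkinAdmissible (dyck w)} ∪
    {w | w.length = n ∧ (∃ v ∈ Set.univ, run .odd w = some v) ∧ MotzkinAdmissible (dyck w)} := by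
  rintro w ⟨x, hx, i, rfl⟩
  obtain ⟨⟨v, v', h1⟩, h2⟩ := (mem_evenOddShift_iff x).1 hx i n
  cases v
  · exact .inl ⟨length_factor _ _ _, ⟨v', trivial, h1⟩, h2⟩
  · exact .inr ⟨length_factor _ _ _, ⟨v', trivial, h1⟩, h2⟩

theorem finite_languageOfLength (n : ℕ) :
    (languageOfLength (evenOddShift Γ).carrier n).Finite := by
  refine (finite_length_eq' n).subset ?_
  rintro w ⟨x, -, i, rfl⟩
  exact length_factor _ _ _

theorem ncard_admissible (n : ℕ) (u : EvenVertex) :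
    ({w : List (EvenOddSymbol Γ) | w.length = n ∧ (∃ v ∈ Set.univ, run u w = some v) ∧
      MotzkinAdmissible (dyck w)}.ncard : ℝ) =
      pathSum (Γ := Unit) (fun _ => 1) n u (labelCount (Fintype.card Γ)) := by
  have := ncard_eq_pathSum (Γ := Γ) Set.univ n u fun w => MotzkinAdmissible (dyck w)
  rw [this, pathSum_eq_pathSum_labelSum]
  simp only [labelSum_motzkinAdmissible, Set.mem_univ, if_true]
  rfl

theorem ncard_periodicPoints_le {n : ℕ} (hn : 0 < n) :
    (periodicPoints (evenOddShift Γ).carrier n).ncard ≤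
      (languageOfLength (evenOddShift Γ).carrier n).ncard := by
  refine Set.ncard_le_ncard_of_injOn (fun x => factor x 0 n) (fun x hx => ⟨x, hx.1, 0, rfl⟩)
    (fun x hx y hy h => ?_) (finite_languageOfLength n)
  exact eq_of_factor_eq_of_period hn (mem_periodicPoints.1 hx).2 (mem_periodicPoints.1 hy).2 h

variable (hN : 2 ≤ (Fintype.card Γ : ℝ))
  (hl : l ^ 2 - (Fintype.card Γ + 2) * l + Fintype.card Γ = 0)
  (hl2 : (Fintype.card Γ : ℝ) + 2 ≤ 2 * l)
include hN hl hl2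

theorem ncard_languageOfLength_le (n : ℕ) :
    ((languageOfLength (evenOddShift Γ).carrier n).ncard : ℝ) ≤
      (1 + n * Fintype.card Γ) * (l ^ n * l) := by
  have hfin : ∀ u, {w : List (EvenOddSymbol Γ) | w.length = n ∧
      (∃ v ∈ Set.univ, run u w = some v) ∧ MotzkinAdmissible (dyck w)}.Finite := fun u =>
    (finite_length_eq' n).subset fun w hw => hw.1
  have h1 := (Set.ncard_le_ncard (languageOfLength_subset (Γ := Γ) n)
    ((hfin .even).union (hfin .odd))).trans (Set.ncard_union_le _ _)
  have h2 : ((languageOfLength (evenOddShift Γ).carrier n).ncard : ℝ) ≤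
      pathSum (Γ := Unit) (fun _ => 1) n .even (labelCount (Fintype.card Γ)) +
      pathSum (Γ := Unit) (fun _ => 1) n .odd (labelCount (Fintype.card Γ)) := by
    rw [← ncard_admissible (Γ := Γ), ← ncard_admissible (Γ := Γ)]
    exact_mod_cast h1
  have h3 := pathSum_labelCount_le hN hl hl2 n .even
  have h4 := pathSum_labelCount_le hN hl hl2 n .odd
  simp only [vertexWeight] at h3 h4
  linarith

/-- Distinct points of period n have distinct words on one period. The sign correction loses at most
1, which is at most half of l^n because l ≥ 2. -/
theorem le_ncard_languageOfLength {n : ℕ} (hn : 0 < n) :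
    l ^ n / 2 ≤ (languageOfLength (evenOddShift Γ).carrier n).ncard := by
  have h1 : ((periodicPoints (evenOddShift Γ).carrier n).ncard : ℝ) ≤
      (languageOfLength (evenOddShift Γ).carrier n).ncard :=
    Nat.cast_le.2 (ncard_periodicPoints_le hn)
  rw [ncard_periodicPoints_eq_traceCoeff hn] at h1
  have h2 := le_traceCoeff (by linarith : (1 : ℝ) ≤ Fintype.card Γ) hl n
  have h3 := pow_nonneg (conj_root_nonneg hN hl hl2) n
  have h4 : (-1 : ℝ) ≤ (-1) ^ (n + 1) := by
    rcases neg_one_pow_eq_or ℝ (n + 1) with h | h <;> rw [h]; norm_num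
  have h5 : l ≤ l ^ n := le_self_pow₀ (by linarith) hn.ne'
  linarith

theorem hasEntropy_log : HasEntropy (evenOddShift Γ).carrier (Real.log l) := by
  have hl0 : 0 < l := by linarith
  set C : ℝ := (1 + Fintype.card Γ) * l
  have hC : 0 < C := by positivity
  have hlog : Tendsto (fun n : ℕ => Real.log n / n) atTop (𝓝 0) :=
    (Real.isLittleO_log_id_atTop.tendsto_div_nhds_zero).comp tendsto_natCast_atTop_atTop
  have hinv : ∀ c : ℝ, Tendsto (fun n : ℕ => c / n) atTop (𝓝 0) := fun c =>
    tendsto_const_div_atTop_nhds_zero_nat c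
  have hlow : Tendsto (fun n : ℕ => Real.log l - Real.log 2 / n) atTop (𝓝 (Real.log l)) := by
    simpa using (hinv (Real.log 2)).const_sub (Real.log l)
  have hup : Tendsto (fun n : ℕ => Real.log l + (Real.log C / n + Real.log n / n)) atTop
      (𝓝 (Real.log l)) := by
    simpa using ((hinv (Real.log C)).add hlog).const_add (Real.log l)
  refine tendsto_of_tendsto_of_tendsto_of_le_of_le' hlow hup ?_ ?_
  · filter_upwards [eventually_gt_atTop 0] with n hn
    have hn' : (0 : ℝ) < n := Nat.cast_pos.2 hn
    have h := Real.log_le_log (by positivity) (le_ncard_languageOfLength hN hl hl2 hn)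
    rw [Real.log_div (by positivity) two_ne_zero, Real.log_pow] at h
    rw [one_div, inv_mul_eq_div, le_div_iff₀ hn', sub_mul, div_mul_cancel₀ _ hn'.ne']
    linarith
  · filter_upwards [eventually_gt_atTop 0] with n hn
    have hn' : (0 : ℝ) < n := Nat.cast_pos.2 hn
    have hn1 : (1 : ℝ) ≤ n := Nat.one_le_cast.2 hn
    have hpos : (0 : ℝ) < (languageOfLength (evenOddShift Γ).carrier n).ncard :=
      lt_of_lt_of_le (by positivity) (le_ncard_languageOfLength hN hl hl2 hn)
    have hle : ((languageOfLength (evenOddShift Γ).carrier n).ncard : ℝ) ≤ C * n * l ^ n := by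
      refine (ncard_languageOfLength_le hN hl hl2 n).trans ?_
      have : (1 + n * Fintype.card Γ : ℝ) ≤ (1 + Fintype.card Γ) * n := by linarith
      calc _ ≤ (1 + Fintype.card Γ : ℝ) * n * (l ^ n * l) := by gcongr
        _ = _ := by ring
    have h := Real.log_le_log hpos hle
    rw [Real.log_mul (by positivity) (by positivity), Real.log_mul hC.ne' hn'.ne',
      Real.log_pow] at h
    rw [one_div, inv_mul_eq_div, div_le_iff₀ hn', add_mul, add_mul, div_mul_cancel₀ _ hn'.ne',
      div_mul_cancel₀ _ hn'.ne']
    linarith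

end language

end SymbDyn

theorem corollary2p11 {Γ : Type*} [Fintype Γ] (N : ℕ) (hN : N = Fintype.card Γ) (hN1 : 1 < N) :
    (∀ z : ℂ, ‖z‖ < ((N : ℝ) + 2 - √(((N : ℝ) + 2) ^ 2 - 4 * N)) / (2 * N) →
      Summable (SymbDyn.zetaTerm (SymbDyn.evenOddShift Γ).carrier z) ∧
      SymbDyn.zeta (SymbDyn.evenOddShift Γ).carrier z =
        2 * (1 + z) * (1 - z - z ^ 2 +
            Complex.sqrt ((1 - z - z ^ 2) ^ 2 - 4 * N * z ^ 2 * (1 - z) ^ 2)) /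
          (1 - (2 * N + 1) * z + (2 * N - 1) * z ^ 2 +
            Complex.sqrt ((1 - z - z ^ 2) ^ 2 - 4 * N * z ^ 2 * (1 - z) ^ 2)) ^ 2) ∧
    SymbDyn.HasEntropy (SymbDyn.evenOddShift Γ).carrier
      (Real.log 2 + Real.log N - Real.log ((N : ℝ) + 2 - √(((N : ℝ) + 2) ^ 2 - 4 * N))) := by
  subst hN
  have hN2 : 2 ≤ (Fintype.card Γ : ℝ) := by exact_mod_cast hN1
  have hs0 := Real.sqrt_nonneg (((Fintype.card Γ : ℝ) + 2) ^ 2 - 4 * Fintype.card Γ)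
  have hs := Real.sq_sqrt (by nlinarith : 0 ≤ ((Fintype.card Γ : ℝ) + 2) ^ 2 - 4 * Fintype.card Γ)
  set s := √(((Fintype.card Γ : ℝ) + 2) ^ 2 - 4 * Fintype.card Γ)
  obtain ⟨l, hls⟩ : ∃ l, l = ((Fintype.card Γ : ℝ) + 2 + s) / 2 := ⟨_, rfl⟩
  have hl : l ^ 2 - (Fintype.card Γ + 2) * l + Fintype.card Γ = 0 := by
    rw [hls]
    linear_combination (1 / 4 : ℝ) * hs
  have hl2 : (Fintype.card Γ : ℝ) + 2 ≤ 2 * l := by linarith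
  have hl0 : 0 < l := by linarith
  -- The roots (N+2±s)/2 have product N; this turns the stated radius into 1/l and the stated
  -- entropy into log l.
  have hmul : ((Fintype.card Γ : ℝ) + 2 - s) * l = 2 * Fintype.card Γ := by
    rw [hls]
    linear_combination (-1 / 2 : ℝ) * hs
  have hpos : 0 < (Fintype.card Γ : ℝ) + 2 - s := by
    by_contra h
    nlinarith
  refine ⟨fun z hz => ?_, ?_⟩
  · have hz' : ‖z‖ * l < 1 := by
      rw [lt_div_iff₀ (by positivity), ← hmul, mul_comm, mul_assoc] at hz
      have : l * ‖z‖ < 1 := by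
        by_contra h
        nlinarith
      linarith
    refine ⟨(SymbDyn.hasDerivAt_tsum_zetaTerm hN2 hl hl2 hz').1, ?_⟩
    rw [SymbDyn.zeta_eq_closedForm hN2 hl hl2 hz', SymbDyn.closedForm_eq hN2 hl hl2 hz',
      Complex.ofReal_natCast]
  · have h := SymbDyn.hasEntropy_log hN2 hl hl2
    have hlog : Real.log l = Real.log 2 + Real.log (Fintype.card Γ) -
        Real.log ((Fintype.card Γ : ℝ) + 2 - s) := by
      rw [← Real.log_mul two_ne_zero (by linarith), ← Real.log_div (by linarith) hpos.ne',
        ← hmul, mul_div_cancel_left₀ _ hpos.ne']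
    rwa [hlog] at h
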